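/- Theorem 4.1. Let $\delta>0$ and let everything be periodic in $x$ with period $1$. Let $\Omega=(0,1]\times(-\delta,1]$, $D=(0,1]^2$, $\mathcal U=\Omega\setminus D=(0,1]\times(-\delta,0]$, and for $h=1/N$, $N\in\mathbb N$, $N\ge 1$, let $\Omega_h=\Omega\cap h\mathbb Z^2$, $D_h=D\cap h\mathbb Z^2$, $\mathcal U_h=\mathcal U\cap h\mathbb Z^2$. Fix $r\in\mathbb N$, $r\ge 2$, and put $\epsilon=rh$. **Boundary data.** $u_0:\mathcal U\to\mathbb R^d$ is $1$-periodic in $x$ and $C^2$ off finitely many (possibly no) curves, taken periodically in $x$. Each curve is a graph $y=f(x)$ of a smooth increasing function $f$ on an interval, lies in $\mathcal U$, and meets the line $y=0$ at a strictly positive angle. Near every point of $\mathcal U$, $u_0$ is bounded and, off the curves, so is its first derivative (so the discontinuities are jumps). **Algorithm.** Let ${\bf g}\in\mathbb R^2$ and $\mu>0$ be constant, and set $$w_\epsilon({\bf x},{\bf y})=\frac1{\|{\bf y}-{\bf x}\|}\exp\Big(-\frac{\mu^2}{2\epsilon^2}\big({\bf g}^\perp\cdot({\bf y}-{\bf x})\big)^2\Big).$$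 The neighbourhood $A_{\epsilon,h}({\bf x})$ is either $B_{\epsilon,h}({\bf x})=\{{\bf y}\in\Omega_h:\|{\bf y}-{\bf x}\|\le\epsilon\}$ (coherence transport) or $\tilde B_{\epsilon,h}({\bf x})=\Omega\cap\{{\bf x}+R{\bf y}:{\bf y}\in h\mathbb Z^2,\ \|{\bf y}\|\le\epsilon\}$ (Guidefill), where $R$ is the rotation taking $(0,1)$ to ${\bf g}/\|{\bf g}\|$, and $R=I$ if ${\bf g}={\bf 0}$. Start with $u_h=u_0$ on $\mathcal U_h$ and $D_h^{(0)}=D_h$. In step $k=0,1,2,\dots$, as long as $D_h^{(k)}\ne\emptyset$, let $D^{(k)}$ be the set of points of $\Omega$ at distance less than $h$ (in the maximum norm) from a pixel of $D_h^{(k)}$. Every pixel ${\bf x}\in D^{(k)}_h$ having one of its eight neighbours in $\Omega_h\setminus D_h^{(k)}$ is given the value $$u_h({\bf x})=\frac{\sum_{{\bf y}\in A_{\epsilon,h}({\bf x})\cap(\Omega\setminus D^{(k)})}w_\epsilon({\bf x},{\bf y})\,u_h({\bf y})}{\sum_{{\bf y}\in A_{\epsilon,h}({\bf x})\cap(\Omega\setminus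 D^{(k)})}w_\epsilon({\bf x},{\bf y})},$$ where $u_h$ is evaluated between pixels by bilinear interpolation. $D_h^{(k+1)}$ is $D_h^{(k)}$ without these pixels. **Limit.** Let $A_r=\{{\bf y}\in\mathbb Z^2:\|{\bf y}\|\le r\}$ for coherence transport and $A_r=R\{{\bf y}\in\mathbb Z^2:\|{\bf y}\|\le r\}$ for Guidefill, let $A_r^-=\{{\bf y}\in A_r:y_2\le-1\}$, and $${\bf g}^*=\frac{\sum_{{\bf y}\in A_r^-}w_r({\bf 0},{\bf y})\,{\bf y}}{\sum_{{\bf y}\in A_r^-}w_r({\bf 0},{\bf y})}.$$ If ${\bf g}^*\cdot e_2\ne0$, let $\theta^*\in(0,\pi)$ be the counterclockwise angle from the $x$-axis to the line spanned by ${\bf g}^*$. The weak solution on $D$ of the transport equation $\nabla u\cdot{\bf g}^*=0$ with $u(x,0)=u_0(x,0)$, periodic in $x$, is by definition $u(x,y)=u_0\big((x-\cot(\theta^*)\,y)\bmod 1,\,0\big)$. **Claim.** There is a constant $K$ depending only on $u_0$ (including its domain) and $r$ such that, for either choice of neighbourhood and all ${\bf g}\in\mathbb R^2$ and $\mu>0$: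 ${\bf g}^*\cdot e_2\neq0$, so that $u$ exists; and for every $h=1/N<\delta/r$ the algorithm fills all of $D_h$, and for every $p\in[1,\infty]$ and each channel (component) of $u$ and $u_h$, $$\|u-u_h\|_p\le K\,h^{\frac1{2p}}\ \text{ if the set of curves is non-empty},\qquad \|u-u_h\|_p\le K\,h\ \text{ if there are no curves,}$$ where $\frac1{2p}=0$ for $p=\infty$, $\|f\|_p=\big(\sum_{{\bf x}\in D_h}|f({\bf x})|^p h^2\big)^{1/p}$ for $p<\infty$, and $\|f\|_\infty=\max_{{\bf x}\in D_h}|f({\bf x})|$. -/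

import Mathlib

open scoped ENNReal ContDiff

noncomputable section

namespace Inpainting

/-! Points of the plane are pairs of reals.  Periodicity in `x` is modelled on the universal cover:
all regions are horizontal strips of the plane, pixels are indexed by `ℤ × ℤ`, and the data are
`1`-periodic in `x`. -/

/-- The Euclidean norm on `ℝ × ℝ` (whose built-in norm is the maximum norm). -/
def eucl (v : ℝ × ℝ) : ℝ := Real.sqrt (v.1 ^ 2 + v.2 ^ 2)

/-- The counterclockwise rotation of `v` by a right angle. -/
def perp (v : ℝ × ℝ) : ℝ × ℝ := (-v.2, v.1)

/-! ### Domains -/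

/-- The image domain `(0,1] × (-δ,1]`, periodic in `x`. -/
def imageDomain (δ : ℝ) : Set (ℝ × ℝ) := {z | -δ < z.2 ∧ z.2 ≤ 1}

/-- The inpainting domain `(0,1] × (0,1]`, periodic in `x`. -/
def inpaintingDomain : Set (ℝ × ℝ) := {z | 0 < z.2 ∧ z.2 ≤ 1}

/-- The undamaged region `(0,1] × (-δ,0]`, periodic in `x`. -/
def undamaged (δ : ℝ) : Set (ℝ × ℝ) := {z | -δ < z.2 ∧ z.2 ≤ 0}

/-- The centre `(i h, j h)` of the pixel `(i, j)`. -/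
def pos (h : ℝ) (q : ℤ × ℤ) : ℝ × ℝ := (q.1 * h, q.2 * h)

/-- The pixels whose centres lie in `S`. -/
def pixelsIn (S : Set (ℝ × ℝ)) (h : ℝ) : Set (ℤ × ℤ) := {q | pos h q ∈ S}

/-- The continuous version of a set `Dh` of pixels inside `Ω`, with its one pixel wide buffer:
the points of `Ω` at distance less than `h`, in the maximum norm, from a pixel of `Dh`. -/
def continuousRegion (Ω : Set (ℝ × ℝ)) (h : ℝ) (Dh : Set (ℤ × ℤ)) : Set (ℝ × ℝ) :=
  {z ∈ Ω | ∃ q ∈ Dh, ‖pos h q - z‖ < h}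

/-! ### Neighbourhoods and weights -/

/-- The two algorithms considered. -/
inductive Scheme where
  | coherenceTransport
  | guidefill

/-- The rotation of the plane that takes `(0,1)` to `g / ‖g‖`, and the identity if `g = 0`. -/
def rotateTo (g y : ℝ × ℝ) : ℝ × ℝ :=
  open Classical in
  if g = 0 then y
  else ((y.1 * g.2 + y.2 * g.1) / eucl g, (-(y.1 * g.1) + y.2 * g.2) / eucl g)

/-- The neighbourhood of radius `ε` of `x` in `Ω`: the ball of the lattice `h ℤ²` for coherence
transport, and that ball rotated about `x` into the direction `g` for Guidefill. -/
def neighbourhood (s : Scheme) (Ω : Set (ℝ × ℝ)) (g : ℝ × ℝ) (h ε : ℝ) (x : ℝ × ℝ) :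
    Set (ℝ × ℝ) :=
  match s with
  | .coherenceTransport => {z ∈ Ω | (∃ q, z = pos h q) ∧ eucl (z - x) ≤ ε}
  | .guidefill => {z ∈ Ω | ∃ q, eucl (pos h q) ≤ ε ∧ z = x + rotateTo g (pos h q)}

/-- The weight `‖y - x‖⁻¹ exp (-(μ² / (2 ε²)) (g^⊥ ⬝ (y - x))²)`. -/
def weight (μ : ℝ) (g : ℝ × ℝ) (ε : ℝ) (x y : ℝ × ℝ) : ℝ :=
  1 / eucl (y - x) *
    Real.exp (-(μ ^ 2 / (2 * ε ^ 2)) *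
      ((perp g).1 * (y - x).1 + (perp g).2 * (y - x).2) ^ 2)

/-! ### Shell based inpainting, onion shell order, no bystander pixels -/

/-- The basis function of bilinear interpolation at the pixel `q`. -/
def bilinearBasis (h : ℝ) (q : ℤ × ℤ) (z : ℝ × ℝ) : ℝ :=
  max 0 (1 - |z.1 - (pos h q).1| / h) * max 0 (1 - |z.2 - (pos h q).2| / h)

/-- Bilinear interpolation of the pixel values `u` (only finitely many terms are nonzero). -/
def interpolate {d : ℕ} (Ω : Set (ℝ × ℝ)) (h : ℝ) (u : ℤ × ℤ → Fin d → ℝ) (z : ℝ × ℝ) :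
    Fin d → ℝ :=
  ∑ᶠ q ∈ pixelsIn Ω h, bilinearBasis h q z • u q

/-- The eight-point neighbourhood of a pixel. -/
def eightNeighbours (q : ℤ × ℤ) : Set (ℤ × ℤ) :=
  {q' | q' ≠ q ∧ |q'.1 - q.1| ≤ 1 ∧ |q'.2 - q.2| ≤ 1}

/-- The discrete inner boundary of a set of pixels. -/
def innerBoundary (Dh : Set (ℤ × ℤ)) : Set (ℤ × ℤ) :=
  {q ∈ Dh | (eightNeighbours q ∩ Dhᶜ).Nonempty}

/-- The active boundary: the boundary pixels with a readable neighbour. -/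
def activeBoundary (Ω : Set (ℝ × ℝ)) (h : ℝ) (Dh : Set (ℤ × ℤ)) : Set (ℤ × ℤ) :=
  {q ∈ innerBoundary Dh | (eightNeighbours q ∩ (pixelsIn Ω h \ Dh)).Nonempty}

/-- The state of the algorithm: the pixels still to be filled and the current image. -/
structure State (d : ℕ) where
  region : Set (ℤ × ℤ)
  image : ℤ × ℤ → Fin d → ℝ

/-- The weighted average over the readable part of the neighbourhood `A x`. -/
def fillValue {d : ℕ} (Ω : Set (ℝ × ℝ)) (h : ℝ) (A : ℝ × ℝ → Set (ℝ × ℝ))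
    (w : ℝ × ℝ → ℝ × ℝ → ℝ) (S : State d) (x : ℝ × ℝ) : Fin d → ℝ :=
  (∑ᶠ y ∈ A x ∩ (Ω \ continuousRegion Ω h S.region), w x y)⁻¹ •
    ∑ᶠ y ∈ A x ∩ (Ω \ continuousRegion Ω h S.region), w x y • interpolate Ω h S.image y

/-- One iteration: every pixel of the active boundary is filled and removed from the region. -/
def fillShell {d : ℕ} (Ω : Set (ℝ × ℝ)) (h : ℝ) (A : ℝ × ℝ → Set (ℝ × ℝ))
    (w : ℝ × ℝ → ℝ × ℝ → ℝ) (S : State d) : State d where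
  region := S.region \ activeBoundary Ω h S.region
  image := fun q =>
    open Classical in
    if q ∈ activeBoundary Ω h S.region then fillValue Ω h A w S (pos h q) else S.image q

/-- The initial state: the pixels of the inpainting domain are to be filled (and hold the value
`0`, which is never read); the others carry the values of `u₀`. -/
def initialState {d : ℕ} (u₀ : ℝ × ℝ → Fin d → ℝ) (h : ℝ) : State d where
  region := pixelsIn inpaintingDomain h
  image := fun q =>
    open Classical in
    if q ∈ pixelsIn inpaintingDomain h then 0 else u₀ (pos h q)

/-- The state after `k` iterations with pixel width `h` and radius `ε = r h`. -/
def stateAfter {d : ℕ} (s : Scheme) (δ : ℝ) (u₀ : ℝ × ℝ → Fin d → ℝ) (g : ℝ × ℝ) (μ : ℝ)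
    (r : ℕ) (h : ℝ) (k : ℕ) : State d :=
  (fillShell (imageDomain δ) h (neighbourhood s (imageDomain δ) g h (r * h))
    (weight μ g (r * h)))^[k] (initialState u₀ h)

/-- The output `u_h`: the image at the first step at which no pixel remains to be filled. -/
def inpainted {d : ℕ} (s : Scheme) (δ : ℝ) (u₀ : ℝ × ℝ → Fin d → ℝ) (g : ℝ × ℝ) (μ : ℝ)
    (r : ℕ) (h : ℝ) : ℤ × ℤ → Fin d → ℝ :=
  (stateAfter s δ u₀ g μ r h (sInf {k | (stateAfter s δ u₀ g μ r h k).region = ∅})).image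

/-! ### The limiting transport direction and the weak solution -/

/-- The discrete half-ball `A_r^-`, in units of one pixel. -/
def halfBall (s : Scheme) (g : ℝ × ℝ) (r : ℕ) : Set (ℝ × ℝ) :=
  {y ∈ neighbourhood s Set.univ g 1 r 0 | y.2 ≤ -1}

/-- The weighted centre of mass `g*` of the half-ball. -/
def transportDirection (s : Scheme) (g : ℝ × ℝ) (μ : ℝ) (r : ℕ) : ℝ × ℝ :=
  (∑ᶠ y ∈ halfBall s g r, weight μ g r 0 y)⁻¹ •
    ∑ᶠ y ∈ halfBall s g r, weight μ g r 0 y • y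

/-- `θ ∈ (0, π)` is the counterclockwise angle from the `x`-axis to the line spanned by `v`. -/
def IsLineAngle (v : ℝ × ℝ) (θ : ℝ) : Prop :=
  v ≠ 0 ∧ θ ∈ Set.Ioo 0 Real.pi ∧ v.1 * Real.sin θ = v.2 * Real.cos θ

/-- The weak solution of the transport equation along the direction of angle `θ`, with boundary
values `u₀ (x, 0)`; as `u₀` is `1`-periodic in `x`, no reduction mod `1` is needed. -/
def weakSolution {d : ℕ} (u₀ : ℝ × ℝ → Fin d → ℝ) (θ : ℝ) (z : ℝ × ℝ) : Fin d → ℝ :=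
  u₀ (z.1 - Real.cot θ * z.2, 0)

/-! ### Boundary data -/

/-- A smooth curve in the undamaged region, the graph `y = f x` of an increasing function over an
interval, which meets the line `y = 0` at a positive angle. -/
structure JumpCurve (δ : ℝ) where
  interval : Set ℝ
  f : ℝ → ℝ
  ordConnected : interval.OrdConnected
  smooth : ContDiffOn ℝ ∞ f interval
  monotone : MonotoneOn f interval
  mapsTo : Set.MapsTo f interval (Set.Ioc (-δ) 0)
  meets : ∃ a ∈ interval, f a = 0 ∧ 0 < derivWithin f interval a

/-- The union of the curves and of all their translates by integers in the direction of `x`. -/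
def jumpSet {δ : ℝ} {n : ℕ} (C : Fin n → JumpCurve δ) : Set (ℝ × ℝ) :=
  {z | ∃ i, ∃ x ∈ (C i).interval, ∃ m : ℤ, z = (x + m, (C i).f x)}

/-- `u₀` is piecewise `C²` on the (periodic) undamaged region: it is `1`-periodic in `x`, it is `C²`
off the curves, and `u₀` and its first derivative off the curves are bounded near every point of
the region (so that the discontinuities across the curves are jumps). -/
structure IsPiecewiseC2 {d : ℕ} (δ : ℝ) (u₀ : ℝ × ℝ → Fin d → ℝ) {n : ℕ}
    (C : Fin n → JumpCurve δ) : Prop where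
  periodic : ∀ z ∈ undamaged δ, u₀ (z.1 + 1, z.2) = u₀ z
  contDiffOn : ContDiffOn ℝ 2 u₀ (undamaged δ \ jumpSet C)
  locallyBounded : ∀ z ∈ undamaged δ, ∃ M : ℝ, ∀ᶠ w in nhdsWithin z (undamaged δ),
    ‖u₀ w‖ ≤ M ∧
      (w ∉ jumpSet C → ‖fderivWithin ℝ u₀ (undamaged δ \ jumpSet C) w‖ ≤ M)

/-! ### Discrete norms -/

/-- The `N × N` pixels of one period of the inpainting domain. -/
def pixelGrid (N : ℕ) : Finset (ℤ × ℤ) := Finset.Icc 1 (N : ℤ) ×ˢ Finset.Icc 1 (N : ℤ)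

/-- The discrete `L^p` norm on the `N × N` grid, with pixel width `1 / N`. -/
def discreteNorm (p : ℝ≥0∞) (N : ℕ) (f : ℤ × ℤ → ℝ) : ℝ :=
  open Classical in
  if p = ⊤ then ⨆ q : pixelGrid N, |f q|
  else (∑ q ∈ pixelGrid N, |f q| ^ p.toReal * (1 / (N : ℝ)) ^ 2) ^ (1 / p.toReal)

end Inpainting

end

open Inpainting

/-!
A filled pixel lying `j` rows above the line `y = 0` is an average of pixels in the `r` rows below
it, with weights that depend only on the offset and whose mean points in the direction `g*`. Such
averages preserve the first integral `x - cot θ* y`, and increase the square of its deviation by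
`O(h²)` only. A quadratic barrier of slope `O(h)` in `j` therefore bounds the error at a pixel, over
at most `1 / h` rows, by the modulus of the data around the foot `x'` of its characteristic. For
data without jumps this is `O(h)`. A jump at `a` contributes `O(h / ((x' - a)² + h))`, the chance
that a random walk of variance `O(h)` started at `x'` ends beyond `a`; these terms are bounded, and
their mean over the grid is `O(√h)`. Interpolation between `L¹` and `L^∞` gives the exponent
`1 / (2p)`.
-/

namespace Inpainting

/-! ### Averaging stencils -/

section Stencil

variable {r : ℕ} {p p₀ q : ℤ × ℤ} {ρ : ℤ × ℤ → ℝ} {v : ℝ × ℝ}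

/-- The offsets read by an averaging stencil of radius `r`, all of them in the rows below. -/
noncomputable def stencilBox (r : ℕ) : Finset (ℤ × ℤ) :=
  Finset.Icc (-(r : ℤ)) r ×ˢ Finset.Icc (-(r : ℤ)) (-1)

lemma mem_stencilBox :
    q ∈ stencilBox r ↔ (-(r : ℤ) ≤ q.1 ∧ q.1 ≤ r) ∧ -(r : ℤ) ≤ q.2 ∧ q.2 ≤ -1 := by
  simp [stencilBox]

/-- Nonnegative weights of total mass `1` on the offsets of radius `r`, with mean `v`. -/
structure IsStencil (r : ℕ) (ρ : ℤ × ℤ → ℝ) (v : ℝ × ℝ) : Prop where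
  nonneg : ∀ q, 0 ≤ ρ q
  sum_eq_one : ∑ q ∈ stencilBox r, ρ q = 1
  sum_fst : ∑ q ∈ stencilBox r, ρ q * q.1 = v.1
  sum_snd : ∑ q ∈ stencilBox r, ρ q * q.2 = v.2

/-- The abscissa at which the line of inverse slope `m` through `z` meets the line `y = 0`; it is
the foot of the characteristic through `z` when `m` is the cotangent of the transport angle. -/
def foot (m : ℝ) (z : ℝ × ℝ) : ℝ := z.1 - m * z.2

lemma foot_pos_add (m h : ℝ) (p q : ℤ × ℤ) :
    foot m (pos h (p + q)) = foot m (pos h p) + h * foot m (pos 1 q) := by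
  simp only [foot, pos, Prod.fst_add, Prod.snd_add, Int.cast_add]
  ring

namespace IsStencil

lemma sum_mul_le (hρ : IsStencil r ρ v) {f : ℤ × ℤ → ℝ} {c : ℝ}
    (hf : ∀ q ∈ stencilBox r, f q ≤ c) : ∑ q ∈ stencilBox r, ρ q * f q ≤ c := by
  calc ∑ q ∈ stencilBox r, ρ q * f q ≤ ∑ q ∈ stencilBox r, ρ q * c :=
        Finset.sum_le_sum fun q hq => mul_le_mul_of_nonneg_left (hf q hq) (hρ.nonneg q)
    _ = c := by rw [← Finset.sum_mul, hρ.sum_eq_one, one_mul]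

lemma snd_le (hρ : IsStencil r ρ v) : v.2 ≤ -1 := by
  rw [← hρ.sum_snd]
  exact hρ.sum_mul_le fun q hq => mod_cast (mem_stencilBox.1 hq).2.2

lemma abs_fst_le (hρ : IsStencil r ρ v) : |v.1| ≤ r := by
  have upper : v.1 ≤ r := by
    rw [← hρ.sum_fst]
    exact hρ.sum_mul_le fun q hq => mod_cast (mem_stencilBox.1 hq).1.2
  have lower : -v.1 ≤ r := by
    rw [← hρ.sum_fst, ← Finset.sum_neg_distrib]
    simp only [← mul_neg]
    exact hρ.sum_mul_le fun q hq => neg_le.1 (mod_cast (mem_stencilBox.1 hq).1.1)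
  exact abs_le.2 ⟨neg_le.1 lower, upper⟩

lemma abs_div_le (hρ : IsStencil r ρ v) : |v.1 / v.2| ≤ r := by
  have one_le : 1 ≤ |v.2| := le_abs.2 (.inr (le_neg.1 hρ.snd_le))
  rw [abs_div]
  exact div_le_of_le_mul₀ (by positivity) (by positivity)
    (hρ.abs_fst_le.trans (le_mul_of_one_le_right (by positivity) one_le))

lemma sum_foot_offset (hρ : IsStencil r ρ v) :
    ∑ q ∈ stencilBox r, ρ q * foot (v.1 / v.2) (pos 1 q) = 0 := by
  have hv : v.2 ≠ 0 := by linarith [hρ.snd_le]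
  calc ∑ q ∈ stencilBox r, ρ q * foot (v.1 / v.2) (pos 1 q)
      = ∑ q ∈ stencilBox r, ρ q * q.1 - v.1 / v.2 * ∑ q ∈ stencilBox r, ρ q * q.2 := by
        rw [Finset.mul_sum, ← Finset.sum_sub_distrib]
        exact Finset.sum_congr rfl fun q _ => by simp only [foot, pos]; ring
    _ = 0 := by rw [hρ.sum_fst, hρ.sum_snd, div_mul_cancel₀ _ hv, sub_self]

lemma foot_offset_sq_le (hρ : IsStencil r ρ v) (hq : q ∈ stencilBox r) :
    foot (v.1 / v.2) (pos 1 q) ^ 2 ≤ (r + r ^ 2) ^ 2 := by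
  obtain ⟨⟨hq₁, hq₂⟩, hq₃, hq₄⟩ := mem_stencilBox.1 hq
  have fst_le : |(q.1 : ℝ)| ≤ r := mod_cast abs_le.2 ⟨hq₁, hq₂⟩
  have snd_le : |(q.2 : ℝ)| ≤ r := mod_cast abs_le.2 ⟨hq₃, by omega⟩
  refine sq_le_sq' ?_ ?_ <;> simp only [foot, pos, mul_one]
  all_goals
    have slope_le : |v.1 / v.2 * q.2| ≤ r ^ 2 := by
      rw [abs_mul, sq]; exact mul_le_mul hρ.abs_div_le snd_le (abs_nonneg _) (by positivity)
    rw [abs_le] at fst_le slope_le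
    linarith

lemma sum_foot (hρ : IsStencil r ρ v) (h : ℝ) (p : ℤ × ℤ) :
    ∑ q ∈ stencilBox r, ρ q * foot (v.1 / v.2) (pos h (p + q)) = foot (v.1 / v.2) (pos h p) := by
  simp only [foot_pos_add, mul_add, Finset.sum_add_distrib, ← Finset.sum_mul, hρ.sum_eq_one,
    mul_left_comm _ h, ← Finset.mul_sum, hρ.sum_foot_offset, one_mul, mul_zero, add_zero]

lemma sum_foot_sub_sq_le (hρ : IsStencil r ρ v) (h x : ℝ) (p : ℤ × ℤ) :
    ∑ q ∈ stencilBox r, ρ q * (foot (v.1 / v.2) (pos h (p + q)) - x) ^ 2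
      ≤ (foot (v.1 / v.2) (pos h p) - x) ^ 2 + (r + r ^ 2) ^ 2 * h ^ 2 := by
  set m := v.1 / v.2
  calc ∑ q ∈ stencilBox r, ρ q * (foot m (pos h (p + q)) - x) ^ 2
      = (∑ q ∈ stencilBox r, ρ q) * (foot m (pos h p) - x) ^ 2
        + 2 * (foot m (pos h p) - x) * h * ∑ q ∈ stencilBox r, ρ q * foot m (pos 1 q)
        + (∑ q ∈ stencilBox r, ρ q * foot m (pos 1 q) ^ 2) * h ^ 2 := by
        simp only [foot_pos_add, Finset.sum_mul, Finset.mul_sum, ← Finset.sum_add_distrib]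
        exact Finset.sum_congr rfl fun q _ => by ring
    _ ≤ (foot m (pos h p) - x) ^ 2 + (r + r ^ 2) ^ 2 * h ^ 2 := by
        rw [hρ.sum_eq_one, hρ.sum_foot_offset, one_mul, mul_zero, add_zero]
        gcongr
        exact hρ.sum_mul_le fun q hq => hρ.foot_offset_sq_le hq

end IsStencil

/-- The pixels that the value at `p₀` depends on when every row is averaged from the `r` rows
below it, down to the rows `-r < j ≤ 0` of boundary values. -/
def dependenceCone (r : ℕ) (p₀ : ℤ × ℤ) : Set (ℤ × ℤ) :=
  {p | -(r : ℤ) < p.2 ∧ p.2 ≤ p₀.2 ∧ |p.1 - p₀.1| ≤ r * (p₀.2 - p.2)}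

lemma self_mem_dependenceCone (hp₀ : -(r : ℤ) < p₀.2) : p₀ ∈ dependenceCone r p₀ :=
  ⟨hp₀, le_rfl, by simp⟩

lemma add_mem_dependenceCone (hp : p ∈ dependenceCone r p₀) (hp₁ : 1 ≤ p.2)
    (hq : q ∈ stencilBox r) : p + q ∈ dependenceCone r p₀ := by
  obtain ⟨-, hp₂, hp₃⟩ := hp
  obtain ⟨hq₁, hq₂, hq₃⟩ := mem_stencilBox.1 hq
  refine ⟨by rw [Prod.snd_add]; omega, by rw [Prod.snd_add]; omega, ?_⟩
  calc |(p + q).1 - p₀.1| = |(p.1 - p₀.1) + q.1| := by rw [Prod.fst_add]; ring_nf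
    _ ≤ |p.1 - p₀.1| + |q.1| := abs_add_le _ _
    _ ≤ r * (p₀.2 - p.2) + r := add_le_add hp₃ (abs_le.2 hq₁)
    _ ≤ r * (p₀.2 - (p + q).2) := by rw [Prod.snd_add]; nlinarith

variable {E : Type*} [NormedAddCommGroup E] [NormedSpace ℝ E]

lemma norm_le_of_boundary_le {W : ℤ × ℤ → E} {Φ : ℤ × ℤ → ℝ} (hρ : ∀ q, 0 ≤ ρ q)
    (hW : ∀ p ∈ dependenceCone r p₀, 1 ≤ p.2 → W p = ∑ q ∈ stencilBox r, ρ q • W (p + q))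
    (hΦ : ∀ p ∈ dependenceCone r p₀, 1 ≤ p.2 → ∑ q ∈ stencilBox r, ρ q * Φ (p + q) ≤ Φ p)
    (boundary : ∀ p ∈ dependenceCone r p₀, p.2 ≤ 0 → ‖W p‖ ≤ Φ p)
    (hp : p ∈ dependenceCone r p₀) : ‖W p‖ ≤ Φ p := by
  induction hk : p.2.toNat using Nat.strong_induction_on generalizing p with
  | _ k ih =>
    rcases le_or_gt p.2 0 with hp₀ | hp₁
    · exact boundary p hp hp₀
    calc ‖W p‖ = ‖∑ q ∈ stencilBox r, ρ q • W (p + q)‖ := by rw [← hW p hp hp₁]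
      _ ≤ ∑ q ∈ stencilBox r, ρ q * ‖W (p + q)‖ := by
          refine (norm_sum_le _ _).trans_eq (Finset.sum_congr rfl fun q _ => ?_)
          rw [norm_smul, Real.norm_of_nonneg (hρ q)]
      _ ≤ ∑ q ∈ stencilBox r, ρ q * Φ (p + q) := by
          refine Finset.sum_le_sum fun q hq => mul_le_mul_of_nonneg_left ?_ (hρ q)
          have hq₂ := (mem_stencilBox.1 hq).2.2
          exact ih _ (by rw [Prod.snd_add]; omega) (add_mem_dependenceCone hp hp₁ hq) rfl
      _ ≤ Φ p := hΦ p hp hp₁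

/-- `U` agrees with `b` in the rows `j ≤ 0`, and is averaged by `ρ` in the rows `1, …, N`. -/
structure IsStencilExtension (r : ℕ) (ρ : ℤ × ℤ → ℝ) (N : ℕ) (b U : ℤ × ℤ → E) : Prop where
  boundary : ∀ p : ℤ × ℤ, p.2 ≤ 0 → U p = b p
  average : ∀ p : ℤ × ℤ, 1 ≤ p.2 → p.2 ≤ N → U p = ∑ q ∈ stencilBox r, ρ q • U (p + q)

lemma pixelWidth_pos {h : ℝ} {N : ℕ} (hh : h * N = 1) : 0 < h :=
  pos_of_mul_pos_left (hh ▸ one_pos) N.cast_nonneg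

namespace IsStencilExtension

variable {N : ℕ} {b U : ℤ × ℤ → E} {c β : E} {A h : ℝ}

lemma norm_sub_le_of_affine (hU : IsStencilExtension r ρ N b U) (hρ : IsStencil r ρ v)
    {Φ : ℤ × ℤ → ℝ} (hp₀ : p₀.2 ∈ Set.Icc 1 (N : ℤ))
    (hΦ : ∀ p, ∑ q ∈ stencilBox r, ρ q * Φ (p + q) ≤ Φ p)
    (boundary : ∀ p ∈ dependenceCone r p₀, p.2 ≤ 0 →
      ‖b p - c - (foot (v.1 / v.2) (pos h p) - foot (v.1 / v.2) (pos h p₀)) • β‖ ≤ Φ p) :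
    ‖U p₀ - c‖ ≤ Φ p₀ := by
  have hr : -(r : ℤ) < p₀.2 := by linarith [hp₀.1, Int.natCast_nonneg r]
  have averaged : ∀ p ∈ dependenceCone r p₀, 1 ≤ p.2 →
      U p - c - (foot (v.1 / v.2) (pos h p) - foot (v.1 / v.2) (pos h p₀)) • β
        = ∑ q ∈ stencilBox r, ρ q • (U (p + q) - c
          - (foot (v.1 / v.2) (pos h (p + q)) - foot (v.1 / v.2) (pos h p₀)) • β) := by
    intro p hp hp₁
    simp only [smul_sub, sub_smul, smul_smul, Finset.sum_sub_distrib, ← Finset.sum_smul,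
      hρ.sum_eq_one, hρ.sum_foot, ← Finset.sum_mul, one_smul, one_mul]
    rw [hU.average p hp₁ (hp.2.1.trans hp₀.2)]
  simpa using norm_le_of_boundary_le hρ.nonneg averaged (fun p _ _ => hΦ p)
    (fun p hp hp₂ => by rw [hU.boundary p hp₂]; exact boundary p hp hp₂)
    (self_mem_dependenceCone hr)

lemma norm_sub_le (hU : IsStencilExtension r ρ N b U) (hρ : IsStencil r ρ v)
    (hp₀ : p₀.2 ∈ Set.Icc 1 (N : ℤ))
    (boundary : ∀ p ∈ dependenceCone r p₀, p.2 ≤ 0 → ‖b p - c‖ ≤ A) : ‖U p₀ - c‖ ≤ A := by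
  refine hU.norm_sub_le_of_affine (h := 0) (β := 0) (Φ := fun _ => A) hρ hp₀
    (fun _ => hρ.sum_mul_le fun _ _ => le_rfl) fun p hp hp₂ => ?_
  simpa using boundary p hp hp₂

lemma norm_sub_le_mul (hU : IsStencilExtension r ρ N b U) (hρ : IsStencil r ρ v) (hA : 0 ≤ A)
    (hh : h * N = 1) (hp₀ : p₀.2 ∈ Set.Icc 1 (N : ℤ))
    (boundary : ∀ p ∈ dependenceCone r p₀, p.2 ≤ 0 →
      ‖b p - c - (foot (v.1 / v.2) (pos h p) - foot (v.1 / v.2) (pos h p₀)) • β‖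
        ≤ A * (h + (foot (v.1 / v.2) (pos h p) - foot (v.1 / v.2) (pos h p₀)) ^ 2)) :
    ‖U p₀ - c‖ ≤ A * ((1 + (r + r ^ 2) ^ 2 * (1 + r)) * h) := by
  set m := v.1 / v.2
  set x := foot m (pos h p₀)
  let V : ℝ := (r + r ^ 2) ^ 2
  let Φ : ℤ × ℤ → ℝ := fun p =>
    A * (h + (foot m (pos h p) - x) ^ 2 + V * h ^ 2 * (p.2 + r))
  have superaveraged : ∀ p, ∑ q ∈ stencilBox r, ρ q * Φ (p + q) ≤ Φ p := fun p =>
    calc ∑ q ∈ stencilBox r, ρ q * Φ (p + q)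
        = A * ((∑ q ∈ stencilBox r, ρ q) * (h + V * h ^ 2 * (p.2 + r))
          + ∑ q ∈ stencilBox r, ρ q * (foot m (pos h (p + q)) - x) ^ 2
          + V * h ^ 2 * ∑ q ∈ stencilBox r, ρ q * q.2) := by
          simp only [Finset.sum_mul, Finset.mul_sum, ← Finset.sum_add_distrib]
          refine Finset.sum_congr rfl fun q _ => ?_
          simp only [Φ, Prod.snd_add, Int.cast_add]
          ring
      _ ≤ A * (1 * (h + V * h ^ 2 * (p.2 + r)) + ((foot m (pos h p) - x) ^ 2 + V * h ^ 2)
          + V * h ^ 2 * (-1)) := by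
          rw [hρ.sum_eq_one, hρ.sum_snd]
          gcongr
          exacts [hρ.sum_foot_sub_sq_le h x p, hρ.snd_le]
      _ = Φ p := by simp only [Φ]; ring
  have hh₀ : 0 ≤ h := (pixelWidth_pos hh).le
  have bounded : h * (p₀.2 + r) ≤ 1 + r := by
    have hp₂ : (p₀.2 : ℝ) ≤ N := mod_cast hp₀.2
    have hN₁ : (1 : ℝ) ≤ N := mod_cast hp₀.1.trans hp₀.2
    calc h * (p₀.2 + r) ≤ h * (N + N * r) := by
          gcongr
          exact le_mul_of_one_le_left r.cast_nonneg hN₁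
      _ = 1 + r := by linear_combination (1 + (r : ℝ)) * hh
  calc ‖U p₀ - c‖ ≤ Φ p₀ := by
        refine hU.norm_sub_le_of_affine hρ hp₀ superaveraged fun p hp hp₂ =>
          (boundary p hp hp₂).trans (mul_le_mul_of_nonneg_left ?_ hA)
        have hp₃ : (0 : ℝ) ≤ p.2 + r := mod_cast (by linarith [hp.1] : 0 ≤ p.2 + r)
        exact le_add_of_nonneg_right (by positivity)
    _ = A * (h + V * h * (h * (p₀.2 + r))) := by simp only [Φ, x]; ring
    _ ≤ A * (h + V * h * (1 + r)) := by gcongr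
    _ = A * ((1 + V * (1 + r)) * h) := by ring

end IsStencilExtension

end Stencil

section Interpolation

variable {r : ℕ} {q : ℤ × ℤ} {y : ℝ × ℝ}

/-- The basis function of linear interpolation at the origin. -/
def hat (t : ℝ) : ℝ := max 0 (1 - |t|)

lemma hat_nonneg (t : ℝ) : 0 ≤ hat t := le_max_left _ _

lemma hat_eq_zero {t : ℝ} (ht : 1 ≤ |t|) : hat t = 0 := max_eq_left (sub_nonpos.2 ht)

lemma one_le_abs_sub_of_ne_floor {t : ℝ} {m : ℤ} (h₀ : m ≠ ⌊t⌋) (h₁ : m ≠ ⌊t⌋ + 1) :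
    1 ≤ |t - m| := by
  rcases lt_or_gt_of_ne h₀ with hm | hm
  · have hm' : (m : ℝ) + 1 ≤ ⌊t⌋ := mod_cast hm
    exact le_abs.2 (.inl (by linarith [Int.floor_le t]))
  · have hm' : (⌊t⌋ : ℝ) + 2 ≤ m := mod_cast (by omega : ⌊t⌋ + 2 ≤ m)
    exact le_abs.2 (.inr (by linarith [Int.lt_floor_add_one t]))

lemma sum_hat_mul {a b : ℤ} {t : ℝ} (ha : a ≤ t) (hb : t ≤ b) (F : ℤ → ℝ) :
    ∑ m ∈ Finset.Icc a b, hat (t - m) * F m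
      = (1 - Int.fract t) * F ⌊t⌋ + Int.fract t * F (⌊t⌋ + 1) := by
  have ha' : a ≤ ⌊t⌋ := Int.le_floor.2 ha
  have hb' : ⌊t⌋ ≤ b := Int.cast_le.1 ((Int.floor_le t).trans hb)
  calc ∑ m ∈ Finset.Icc a b, hat (t - m) * F m
      = ∑ m ∈ {⌊t⌋, ⌊t⌋ + 1}, hat (t - m) * F m := by
        refine Finset.sum_congr_of_eq_on_inter (fun m _ hm => ?_) (fun m hm hm' => ?_)
          fun _ _ _ => rfl
        · simp only [Finset.mem_insert, Finset.mem_singleton, not_or] at hm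
          rw [hat_eq_zero (one_le_abs_sub_of_ne_floor hm.1 hm.2), zero_mul]
        · simp only [Finset.mem_insert, Finset.mem_singleton, Finset.mem_Icc] at hm hm'
          have hm₁ : m = b + 1 := by omega
          rw [hat_eq_zero (le_abs.2 (.inr (by rw [hm₁]; push_cast; linarith))), zero_mul]
    _ = (1 - Int.fract t) * F ⌊t⌋ + Int.fract t * F (⌊t⌋ + 1) := by
        have left : hat (t - ⌊t⌋) = 1 - Int.fract t := by
          rw [hat, Int.self_sub_floor, abs_of_nonneg (Int.fract_nonneg t),
            max_eq_right (sub_nonneg.2 (Int.fract_lt_one t).le)]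
        have right : hat (t - (⌊t⌋ + 1 : ℤ)) = Int.fract t := by
          rw [hat, Int.cast_add, Int.cast_one, ← sub_sub, Int.self_sub_floor, abs_sub_comm,
            abs_of_nonneg (sub_nonneg.2 (Int.fract_lt_one t).le), sub_sub_cancel,
            max_eq_right (Int.fract_nonneg t)]
        rw [Finset.sum_pair (by omega), left, right]

lemma sum_hat {a b : ℤ} {t : ℝ} (ha : a ≤ t) (hb : t ≤ b) :
    ∑ m ∈ Finset.Icc a b, hat (t - m) = 1 := by
  simpa using sum_hat_mul ha hb fun _ => 1

lemma sum_hat_mul_self {a b : ℤ} {t : ℝ} (ha : a ≤ t) (hb : t ≤ b) :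
    ∑ m ∈ Finset.Icc a b, hat (t - m) * m = t := by
  rw [sum_hat_mul ha hb fun m => m]
  push_cast
  linarith [Int.floor_add_fract t]

lemma bilinearBasis_one (q : ℤ × ℤ) (y : ℝ × ℝ) :
    bilinearBasis 1 q y = hat (y.1 - q.1) * hat (y.2 - q.2) := by
  simp only [bilinearBasis, pos, hat, mul_one, div_one]

/-- The convex hull of the offsets of a stencil of radius `r`. -/
def stencilHull (r : ℕ) : Set (ℝ × ℝ) :=
  Set.Icc (-(r : ℝ)) r ×ˢ Set.Icc (-(r : ℝ)) (-1)

lemma mem_stencilBox_of_bilinearBasis_ne_zero (hy : y ∈ stencilHull r)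
    (hq : bilinearBasis 1 q y ≠ 0) : q ∈ stencilBox r := by
  rw [bilinearBasis_one] at hq
  have near₁ := abs_lt.1 (not_le.1 (mt hat_eq_zero (left_ne_zero_of_mul hq)))
  have near₂ := abs_lt.1 (not_le.1 (mt hat_eq_zero (right_ne_zero_of_mul hq)))
  obtain ⟨⟨hy₁, hy₂⟩, hy₃, hy₄⟩ := hy
  refine mem_stencilBox.2 ⟨⟨?_, ?_⟩, ?_, ?_⟩ <;> refine Int.lt_add_one_iff.1 ?_ <;>
    refine Int.cast_lt (R := ℝ).1 ?_ <;> push_cast <;> linarith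

lemma isStencil_bilinearBasis (hy : y ∈ stencilHull r) :
    IsStencil r (fun q => bilinearBasis 1 q y) y := by
  obtain ⟨⟨hy₁, hy₂⟩, hy₃, hy₄⟩ := hy
  replace hy₁ : ((-r : ℤ) : ℝ) ≤ y.1 := mod_cast hy₁
  replace hy₃ : ((-r : ℤ) : ℝ) ≤ y.2 := mod_cast hy₃
  replace hy₂ : y.1 ≤ ((r : ℤ) : ℝ) := mod_cast hy₂
  replace hy₄ : y.2 ≤ ((-1 : ℤ) : ℝ) := mod_cast hy₄
  simp only [bilinearBasis_one]
  constructor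
  · exact fun q => mul_nonneg (hat_nonneg _) (hat_nonneg _)
  · simp only [stencilBox, Finset.sum_product, ← Finset.mul_sum, sum_hat hy₃ hy₄, mul_one,
      sum_hat hy₁ hy₂]
  · simp only [stencilBox, Finset.sum_product, mul_right_comm, ← Finset.mul_sum,
      sum_hat hy₃ hy₄, mul_one, sum_hat_mul_self hy₁ hy₂]
  · simp only [stencilBox, Finset.sum_product, mul_assoc, ← Finset.mul_sum,
      sum_hat_mul_self hy₃ hy₄, ← Finset.sum_mul, sum_hat hy₁ hy₂, one_mul]

lemma sum_centerMass_smul {ι κ E : Type*} [AddCommGroup E] [Module ℝ E] (t : Finset ι)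
    (w : ι → ℝ) (s : Finset κ) (ρ : ι → κ → ℝ) (f : κ → E) :
    ∑ q ∈ s, t.centerMass w (fun i => ρ i q) • f q
      = t.centerMass w fun i => ∑ q ∈ s, ρ i q • f q := by
  simp only [Finset.centerMass, smul_eq_mul, mul_smul, ← Finset.smul_sum, Finset.sum_smul]
  rw [Finset.sum_comm]
  simp only [Finset.smul_sum]

lemma IsStencil.centerMass {ι : Type*} {t : Finset ι} {w : ι → ℝ} {ρ : ι → ℤ × ℤ → ℝ}
    {v : ι → ℝ × ℝ} (hw : ∀ i ∈ t, 0 ≤ w i) (hpos : 0 < ∑ i ∈ t, w i)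
    (hρ : ∀ i ∈ t, IsStencil r (ρ i) (v i)) :
    IsStencil r (fun q => t.centerMass w fun i => ρ i q) (t.centerMass w v) := by
  have moment (f : ℤ × ℤ → ℝ) (F : ι → ℝ) (hF : ∀ i ∈ t, ∑ q ∈ stencilBox r, ρ i q * f q = F i) :
      ∑ q ∈ stencilBox r, (t.centerMass w fun i => ρ i q) * f q = t.centerMass w F := by
    refine (sum_centerMass_smul t w (stencilBox r) ρ f).trans ?_
    rw [Finset.centerMass, Finset.centerMass]
    exact congrArg _ (Finset.sum_congr rfl fun i hi => congrArg _ (hF i hi))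
  constructor
  · exact fun q => mul_nonneg (inv_nonneg.2 hpos.le)
      (Finset.sum_nonneg fun i hi => mul_nonneg (hw i hi) ((hρ i hi).nonneg q))
  · have mass := moment (fun _ => 1) (fun _ => 1) fun i hi => by
      simpa only [mul_one] using (hρ i hi).sum_eq_one
    rw [Finset.centerMass, ← Finset.sum_smul, smul_smul, inv_mul_cancel₀ hpos.ne'] at mass
    simpa only [mul_one, smul_eq_mul] using mass
  · rw [moment _ _ fun i hi => (hρ i hi).sum_fst]
    simp only [Finset.centerMass, Prod.smul_fst, Prod.fst_sum]
  · rw [moment _ _ fun i hi => (hρ i hi).sum_snd]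
    simp only [Finset.centerMass, Prod.smul_snd, Prod.snd_sum]

end Interpolation

/-! ### Readable neighbours -/

section HalfBall

variable {s : Scheme} {g : ℝ × ℝ} {μ : ℝ} {r : ℕ}

lemma eucl_eq_norm (v : ℝ × ℝ) : eucl v = ‖Complex.equivRealProdLm.symm v‖ := by
  rw [Complex.norm_eq_sqrt_sq_add_sq]
  rfl

lemma eucl_smul (c : ℝ) (v : ℝ × ℝ) : eucl (c • v) = |c| * eucl v := by
  rw [eucl_eq_norm, map_smul, norm_smul, Real.norm_eq_abs, eucl_eq_norm]

lemma eucl_pos {v : ℝ × ℝ} (hv : v ≠ 0) : 0 < eucl v := by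
  rw [eucl_eq_norm, norm_pos_iff]
  exact (LinearEquiv.map_ne_zero_iff _).2 hv

lemma abs_fst_le_eucl (v : ℝ × ℝ) : |v.1| ≤ eucl v := by
  rw [eucl_eq_norm]
  exact Complex.abs_re_le_norm (Complex.equivRealProdLm.symm v)

lemma abs_snd_le_eucl (v : ℝ × ℝ) : |v.2| ≤ eucl v := by
  rw [eucl_eq_norm]
  exact Complex.abs_im_le_norm (Complex.equivRealProdLm.symm v)

lemma eucl_rotateTo (g y : ℝ × ℝ) : eucl (rotateTo g y) = eucl y := by
  unfold rotateTo
  split_ifs with hg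
  · rfl
  · have g_sq : eucl g ^ 2 = g.1 ^ 2 + g.2 ^ 2 := Real.sq_sqrt (by positivity)
    have g_pos := eucl_pos hg
    unfold eucl at *
    congr 1
    field_simp
    rw [g_sq]
    ring

lemma rotateTo_smul (g : ℝ × ℝ) (c : ℝ) (y : ℝ × ℝ) : rotateTo g (c • y) = c • rotateTo g y := by
  unfold rotateTo
  split_ifs with hg
  · rfl
  · ext <;> simp only [Prod.smul_fst, Prod.smul_snd, smul_eq_mul] <;> ring

/-- The rotation that a scheme applies to the lattice of pixels. -/
noncomputable def Scheme.rotation (s : Scheme) (g : ℝ × ℝ) (y : ℝ × ℝ) : ℝ × ℝ :=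
  match s with
  | .coherenceTransport => y
  | .guidefill => rotateTo g y

lemma Scheme.eucl_rotation (s : Scheme) (g y : ℝ × ℝ) : eucl (s.rotation g y) = eucl y :=
  match s with
  | .coherenceTransport => rfl
  | .guidefill => eucl_rotateTo g y

lemma Scheme.rotation_smul (s : Scheme) (g : ℝ × ℝ) (c : ℝ) (y : ℝ × ℝ) :
    s.rotation g (c • y) = c • s.rotation g y :=
  match s with
  | .coherenceTransport => rfl
  | .guidefill => rotateTo_smul g c y

lemma pos_eq_smul (h : ℝ) (q : ℤ × ℤ) : pos h q = h • pos 1 q := by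
  ext <;> simp [pos, mul_comm]

lemma pos_add (h : ℝ) (p q : ℤ × ℤ) : pos h (p + q) = pos h p + pos h q := by
  ext <;> simp [pos, add_mul]

lemma mem_neighbourhood {Ω : Set (ℝ × ℝ)} {h ε : ℝ} {p : ℤ × ℤ} {z : ℝ × ℝ} :
    z ∈ neighbourhood s Ω g h ε (pos h p) ↔
      z ∈ Ω ∧ ∃ q, eucl (pos h q) ≤ ε ∧ z = pos h p + s.rotation g (pos h q) := by
  cases s
  · refine and_congr_right fun _ => ⟨?_, ?_⟩
    · rintro ⟨⟨q, rfl⟩, hq⟩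
      have hz : pos h q = pos h p + pos h (q - p) := by rw [← pos_add, add_sub_cancel]
      exact ⟨q - p, by rwa [hz, add_sub_cancel_left] at hq, hz⟩
    · rintro ⟨q, hq, rfl⟩
      exact ⟨⟨p + q, (pos_add h p q).symm⟩, by rwa [Scheme.rotation, add_sub_cancel_left]⟩
  · rfl

lemma mem_halfBall {y : ℝ × ℝ} :
    y ∈ halfBall s g r ↔ (∃ q, eucl (pos 1 q) ≤ r ∧ y = s.rotation g (pos 1 q)) ∧ y.2 ≤ -1 := by
  have origin : (0 : ℝ × ℝ) = pos 1 0 := by ext <;> simp [pos]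
  unfold halfBall
  rw [origin, Set.mem_ofPred_eq, mem_neighbourhood, ← origin]
  simp only [Set.mem_univ, true_and, zero_add]

lemma halfBall_subset_stencilHull (s : Scheme) (g : ℝ × ℝ) (r : ℕ) :
    halfBall s g r ⊆ stencilHull r := by
  intro y hy
  obtain ⟨⟨q, hq, hyq⟩, hy₂⟩ := mem_halfBall.1 hy
  have norm_le : eucl y ≤ r := by rwa [hyq, s.eucl_rotation]
  exact ⟨abs_le.1 ((abs_fst_le_eucl y).trans norm_le),
    (abs_le.1 ((abs_snd_le_eucl y).trans norm_le)).1, hy₂⟩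

lemma finite_halfBall (s : Scheme) (g : ℝ × ℝ) (r : ℕ) : (halfBall s g r).Finite := by
  refine (((Set.finite_Icc (-(r : ℤ)) r).prod (Set.finite_Icc (-(r : ℤ)) r)).image
    fun q => s.rotation g (pos 1 q)).subset fun y hy => ?_
  obtain ⟨⟨q, hq, rfl⟩, -⟩ := mem_halfBall.1 hy
  have fst_le := (abs_fst_le_eucl (pos 1 q)).trans hq
  have snd_le := (abs_snd_le_eucl (pos 1 q)).trans hq
  simp only [pos, mul_one] at fst_le snd_le
  exact ⟨q, ⟨abs_le.1 (mod_cast fst_le), abs_le.1 (mod_cast snd_le)⟩, rfl⟩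

lemma halfBall_nonempty (s : Scheme) (g : ℝ × ℝ) (hr : 2 ≤ r) : (halfBall s g r).Nonempty := by
  suffices ∃ q : ℤ × ℤ, eucl (pos 1 q) = 2 ∧ (s.rotation g (pos 1 q)).2 ≤ -1 by
    obtain ⟨q, hq, hq₂⟩ := this
    exact ⟨_, mem_halfBall.2 ⟨⟨q, hq.trans_le (mod_cast hr), rfl⟩, hq₂⟩⟩
  have eucl_eq (q : ℤ × ℤ) (hq : q.1 ^ 2 + q.2 ^ 2 = 2 ^ 2) : eucl (pos 1 q) = 2 := by
    simp only [eucl, pos, mul_one]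
    rw [show ((q.1 : ℝ) ^ 2 + (q.2 : ℝ) ^ 2) = 2 ^ 2 by exact_mod_cast hq,
      Real.sqrt_sq zero_le_two]
  have down : eucl (pos 1 (0, -2)) = 2 := eucl_eq _ (by norm_num)
  cases s with
  | coherenceTransport => exact ⟨(0, -2), down, by norm_num [Scheme.rotation, pos]⟩
  | guidefill =>
    by_cases hg : g = 0
    · exact ⟨(0, -2), down, by norm_num [Scheme.rotation, pos, rotateTo, hg]⟩
    have g_pos := eucl_pos hg
    have g_sq : eucl g ^ 2 = g.1 ^ 2 + g.2 ^ 2 := Real.sq_sqrt (by positivity)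
    -- One of the four axis directions makes an angle of at most `π / 3` with `g`.
    have near_axis : eucl g ≤ 2 * g.1 ∨ eucl g ≤ -(2 * g.1) ∨ eucl g ≤ 2 * g.2 ∨
        eucl g ≤ -(2 * g.2) := by
      by_contra! hcon
      nlinarith
    simp only [Scheme.rotation, rotateTo, if_neg hg, div_le_iff₀ g_pos]
    rcases near_axis with h | h | h | h
    · exact ⟨(2, 0), eucl_eq _ (by norm_num), by simp only [pos]; push_cast; linarith⟩
    · exact ⟨(-2, 0), eucl_eq _ (by norm_num), by simp only [pos]; push_cast; linarith⟩
    · exact ⟨(0, -2), down, by simp only [pos]; push_cast; linarith⟩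
    · exact ⟨(0, 2), eucl_eq _ (by norm_num), by simp only [pos]; push_cast; linarith⟩

lemma weight_pos (μ : ℝ) (g : ℝ × ℝ) (ε : ℝ) {x y : ℝ × ℝ} (h : y ≠ x) : 0 < weight μ g ε x y :=
  mul_pos (div_pos one_pos (eucl_pos (sub_ne_zero.2 h))) (Real.exp_pos _)

lemma weight_smul (μ : ℝ) (g : ℝ × ℝ) (ε : ℝ) {h : ℝ} (hh : 0 < h) (x y : ℝ × ℝ) :
    weight μ g (ε * h) x (x + h • y) = h⁻¹ * weight μ g ε 0 y := by
  have exponent :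
      -(μ ^ 2 / (2 * (ε * h) ^ 2)) * ((perp g).1 * (h * y.1) + (perp g).2 * (h * y.2)) ^ 2
        = -(μ ^ 2 / (2 * ε ^ 2)) * ((perp g).1 * y.1 + (perp g).2 * y.2) ^ 2 := by
    rcases eq_or_ne ε 0 with rfl | hε
    · simp only [zero_mul, ne_eq, OfNat.ofNat_ne_zero, not_false_eq_true, zero_pow, mul_zero,
        div_zero, neg_zero]
    · field_simp
  simp only [weight, add_sub_cancel_left, sub_zero, eucl_smul, abs_of_pos hh, Prod.smul_fst,
    Prod.smul_snd, smul_eq_mul, exponent, one_div, mul_inv, mul_assoc]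

lemma weight_zero_pos_of_mem_halfBall (μ : ℝ) {y : ℝ × ℝ} (hy : y ∈ halfBall s g r) :
    0 < weight μ g r 0 y :=
  weight_pos _ _ _ fun h₀ => by
    have hy₂ := (mem_halfBall.1 hy).2
    rw [h₀] at hy₂
    norm_num at hy₂

/-- The weight with which the pixel at a given offset enters a filled value, after expansion of the
bilinear interpolation. -/
noncomputable def stencilWeight (s : Scheme) (g : ℝ × ℝ) (μ : ℝ) (r : ℕ) (q : ℤ × ℤ) : ℝ :=
  (finite_halfBall s g r).toFinset.centerMass (weight μ g r 0) (bilinearBasis 1 q)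

lemma sum_weight_pos (s : Scheme) (g : ℝ × ℝ) (μ : ℝ) (hr : 2 ≤ r) :
    0 < ∑ y ∈ (finite_halfBall s g r).toFinset, weight μ g r 0 y :=
  Finset.sum_pos
    (fun _ hy => weight_zero_pos_of_mem_halfBall μ ((finite_halfBall s g r).mem_toFinset.1 hy))
    ((finite_halfBall s g r).toFinset_nonempty.2 (halfBall_nonempty s g hr))

lemma transportDirection_eq_centerMass (s : Scheme) (g : ℝ × ℝ) (μ : ℝ) (r : ℕ) :
    transportDirection s g μ r
      = (finite_halfBall s g r).toFinset.centerMass (weight μ g r 0) id := by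
  simp only [transportDirection, Finset.centerMass, id_eq,
    finsum_mem_eq_finite_toFinset_sum _ (finite_halfBall s g r)]

lemma isStencil_stencilWeight (s : Scheme) (g : ℝ × ℝ) (μ : ℝ) (hr : 2 ≤ r) :
    IsStencil r (stencilWeight s g μ r) (transportDirection s g μ r) := by
  rw [transportDirection_eq_centerMass]
  refine IsStencil.centerMass (ρ := fun y q => bilinearBasis 1 q y) (fun y hy => ?_)
    (sum_weight_pos s g μ hr) fun y hy => ?_ <;>
    rw [(finite_halfBall s g r).mem_toFinset] at hy
  · exact (weight_zero_pos_of_mem_halfBall μ hy).le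
  · exact isStencil_bilinearBasis (halfBall_subset_stencilHull s g r hy)

end HalfBall

/-! ### The algorithm as a stencil -/

section Algorithm

variable {d N r k : ℕ} {δ h : ℝ} {p : ℤ × ℤ}

/-- The pixel rows `k < j ≤ N`. -/
def rowsAbove (N k : ℕ) : Set (ℤ × ℤ) := {q | (k : ℤ) < q.2 ∧ q.2 ≤ N}

lemma rowsAbove_eq_empty_iff : rowsAbove N k = ∅ ↔ N ≤ k := by
  refine ⟨fun h => ?_, fun h => Set.eq_empty_of_forall_notMem fun q hq => ?_⟩
  · by_contra! hk
    have mem : ((0 : ℤ), (N : ℤ)) ∈ rowsAbove N k := ⟨Int.ofNat_lt.2 hk, le_rfl⟩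
    rwa [h] at mem
  · have := hq.1.trans_le hq.2
    omega

lemma pixelsIn_inpaintingDomain (hh : h * N = 1) :
    pixelsIn inpaintingDomain h = rowsAbove N 0 := by
  have h_pos := pixelWidth_pos hh
  ext q
  refine and_congr ?_ ?_ <;> simp only [pos]
  · rw [mul_pos_iff_of_pos_right h_pos, Int.cast_pos, Nat.cast_zero]
  · rw [← hh, mul_comm h, mul_le_mul_iff_left₀ h_pos]
    exact_mod_cast Iff.rfl

lemma pos_mem_imageDomain (hh : h * N = 1) (hδ : r * h < δ) (hp : -(r : ℤ) ≤ p.2)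
    (hpN : p.2 ≤ N) : pos h p ∈ imageDomain δ := by
  have h_pos := pixelWidth_pos hh
  have hp' : -(r : ℝ) ≤ p.2 := mod_cast hp
  have hpN' : (p.2 : ℝ) ≤ N := mod_cast hpN
  constructor <;> simp only [pos] <;> nlinarith

lemma activeBoundary_rowsAbove (hh : h * N = 1) (hδ : r * h < δ) :
    activeBoundary (imageDomain δ) h (rowsAbove N k) =
      {q : ℤ × ℤ | q.2 = (k : ℤ) + 1 ∧ q.2 ≤ (N : ℤ)} := by
  have h_pos := pixelWidth_pos hh
  ext q
  constructor
  · rintro ⟨⟨⟨hq, hqN⟩, -⟩, q', ⟨-, -, adjacent⟩, readable, unfilled⟩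
    have hqN' : q'.2 ≤ N := by
      have hle : (q'.2 : ℝ) * h ≤ N * h := by rw [mul_comm (N : ℝ), hh]; exact readable.2
      exact_mod_cast le_of_mul_le_mul_right hle h_pos
    have hqk : q'.2 ≤ k := not_lt.1 fun hlt => unfilled ⟨hlt, hqN'⟩
    rw [abs_le] at adjacent
    exact ⟨by omega, hqN⟩
  · rintro ⟨hq, hqN⟩
    have below_mem : (q.1, q.2 - 1) ∈ eightNeighbours q :=
      ⟨fun e => by simpa using congrArg Prod.snd e, by simp, by simp⟩
    have below_notMem : (q.1, q.2 - 1) ∉ rowsAbove N k := fun hmem => by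
      have := hmem.1
      dsimp only at this
      omega
    exact ⟨⟨⟨by omega, hqN⟩, _, below_mem, below_notMem⟩, _, below_mem,
      pos_mem_imageDomain hh hδ (by dsimp only; omega) (by dsimp only; omega), below_notMem⟩

lemma norm_pos_round_ceil_sub_lt (h_pos : 0 < h) (z : ℝ × ℝ) :
    ‖pos h (round (z.1 / h), ⌈z.2 / h⌉) - z‖ < h := by
  rw [Prod.norm_def, max_lt_iff]
  simp only [pos, Prod.fst_sub, Prod.snd_sub, Real.norm_eq_abs]
  constructor
  · calc |(round (z.1 / h) : ℝ) * h - z.1| = |z.1 / h - round (z.1 / h)| * h := by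
          rw [abs_sub_comm, ← abs_of_pos h_pos, ← abs_mul, abs_of_pos h_pos, sub_mul,
            div_mul_cancel₀ _ h_pos.ne']
      _ ≤ 1 / 2 * h := by gcongr; exact abs_sub_round _
      _ < h := by linarith
  · have lower := Int.le_ceil (z.2 / h)
    have upper := Int.ceil_lt_add_one (z.2 / h)
    rw [div_le_iff₀ h_pos] at lower
    rw [← sub_lt_iff_lt_add, lt_div_iff₀ h_pos] at upper
    exact abs_lt.2 ⟨by linarith, by linarith⟩

lemma mem_continuousRegion_rowsAbove (hh : h * N = 1) {z : ℝ × ℝ} (hz : z ∈ imageDomain δ) :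
    z ∈ continuousRegion (imageDomain δ) h (rowsAbove N k) ↔ k * h < z.2 := by
  have h_pos := pixelWidth_pos hh
  constructor
  · rintro ⟨-, q, ⟨hq, -⟩, near⟩
    have near₂ := (abs_lt.1 ((norm_snd_le (pos h q - z)).trans_lt near)).2
    have hq' : (k : ℝ) + 1 ≤ q.2 := mod_cast hq
    simp only [Prod.snd_sub, pos] at near₂
    nlinarith
  · intro hk
    refine ⟨hz, _, ⟨?_, ?_⟩, norm_pos_round_ceil_sub_lt h_pos z⟩
    · rw [Int.lt_ceil, Int.cast_natCast]
      exact (lt_div_iff₀ h_pos).2 hk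
    · rw [Int.ceil_le, div_le_iff₀ h_pos, Int.cast_natCast, mul_comm, hh]
      exact hz.2

lemma snd_pos_add_smul (hp : p.2 = k + 1) (y : ℝ × ℝ) :
    (pos h p + h • y).2 = k * h + h * (1 + y.2) := by
  simp only [pos, hp, Prod.snd_add, Prod.smul_snd, smul_eq_mul]
  push_cast
  ring

lemma add_smul_mem_imageDomain (hh : h * N = 1) (hδ : r * h < δ) (hp : p.2 = k + 1)
    (hpN : p.2 ≤ N) {y : ℝ × ℝ} (hy : y ∈ stencilHull r) :
    pos h p + h • y ∈ imageDomain δ := by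
  have h_pos := pixelWidth_pos hh
  obtain ⟨-, hy₁, hy₂⟩ := hy
  have hkN : (k : ℝ) + 1 ≤ N := by rw [hp] at hpN; exact_mod_cast hpN
  rw [imageDomain, Set.mem_ofPred_eq, snd_pos_add_smul hp]
  constructor <;> nlinarith [Nat.cast_nonneg (α := ℝ) k]

/-- The buffer of the unfilled region is exactly what restricts the ball to its lower half. -/
lemma readable_neighbours (s : Scheme) (g : ℝ × ℝ) (hh : h * N = 1) (hδ : r * h < δ)
    (hp : p.2 = k + 1) (hpN : p.2 ≤ N) :
    neighbourhood s (imageDomain δ) g h (r * h) (pos h p) ∩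
        (imageDomain δ \ continuousRegion (imageDomain δ) h (rowsAbove N k))
      = (fun y => pos h p + h • y) '' halfBall s g r := by
  have h_pos := pixelWidth_pos hh
  have norm_le_iff (q : ℤ × ℤ) : eucl (pos h q) ≤ r * h ↔ eucl (pos 1 q) ≤ r := by
    rw [pos_eq_smul h q, eucl_smul, abs_of_pos h_pos, mul_comm, mul_le_mul_iff_left₀ h_pos]
  have readable_iff {y : ℝ × ℝ} (hz : pos h p + h • y ∈ imageDomain δ) :
      pos h p + h • y ∉ continuousRegion (imageDomain δ) h (rowsAbove N k) ↔ y.2 ≤ -1 := by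
    rw [mem_continuousRegion_rowsAbove hh hz, snd_pos_add_smul hp, not_lt, add_le_iff_nonpos_right,
      mul_nonpos_iff_pos_imp_nonpos]
    exact ⟨fun H => by linarith [H.1 h_pos], fun H => ⟨fun _ => by linarith, fun _ => h_pos.le⟩⟩
  ext z
  constructor
  · rintro ⟨hz, -, hz'⟩
    obtain ⟨hz, q, hq, rfl⟩ := mem_neighbourhood.1 hz
    rw [pos_eq_smul h q, s.rotation_smul] at hz hz' ⊢
    exact ⟨_, mem_halfBall.2 ⟨⟨q, (norm_le_iff q).1 hq, rfl⟩, (readable_iff hz).1 hz'⟩, rfl⟩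
  · rintro ⟨y, hy, rfl⟩
    have hz := add_smul_mem_imageDomain hh hδ hp hpN (halfBall_subset_stencilHull s g r hy)
    obtain ⟨⟨q, hq, rfl⟩, hy₂⟩ := mem_halfBall.1 hy
    refine ⟨mem_neighbourhood.2 ⟨hz, q, (norm_le_iff q).2 hq, ?_⟩, hz, (readable_iff hz).2 hy₂⟩
    rw [pos_eq_smul h q, s.rotation_smul]

lemma bilinearBasis_pos_add (h_pos : 0 < h) (p q : ℤ × ℤ) (y : ℝ × ℝ) :
    bilinearBasis h (p + q) (pos h p + h • y) = bilinearBasis 1 q y := by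
  have rescale (a b : ℤ) (t : ℝ) :
      |(a : ℝ) * h + h * t - ((a + b : ℤ) : ℝ) * h| / h = |t - b| := by
    rw [div_eq_iff h_pos.ne', ← abs_of_pos h_pos, ← abs_mul, abs_of_pos h_pos]
    congr 1
    push_cast
    ring
  rw [bilinearBasis_one]
  simp only [bilinearBasis, hat, pos, Prod.fst_add, Prod.snd_add,
    Prod.smul_fst, Prod.smul_snd, smul_eq_mul, rescale]

lemma interpolate_eq_sum (hh : h * N = 1) (hδ : r * h < δ) (hp : 1 ≤ p.2) (hpN : p.2 ≤ N)
    (u : ℤ × ℤ → Fin d → ℝ) {y : ℝ × ℝ} (hy : y ∈ stencilHull r) :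
    interpolate (imageDomain δ) h u (pos h p + h • y)
      = ∑ q ∈ stencilBox r, bilinearBasis 1 q y • u (p + q) := by
  have h_pos := pixelWidth_pos hh
  rw [interpolate, finsum_mem_eq_sum_of_inter_support_eq _
    (t := (stencilBox r).map (addLeftEmbedding p)), Finset.sum_map]
  · simp only [addLeftEmbedding_apply, bilinearBasis_pos_add h_pos]
  · ext q'
    obtain ⟨q, rfl⟩ : ∃ q, q' = p + q := ⟨q' - p, by abel⟩
    simp only [Set.mem_inter_iff, Function.mem_support, bilinearBasis_pos_add h_pos,
      Finset.mem_coe, Finset.mem_map, addLeftEmbedding_apply, add_right_inj, exists_eq_right]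
    refine and_congr_left fun ne_zero => ?_
    have hq : q ∈ stencilBox r :=
      mem_stencilBox_of_bilinearBasis_ne_zero hy fun e => ne_zero (by rw [e, zero_smul])
    have hq₂ := (mem_stencilBox.1 hq).2
    exact iff_of_true (pos_mem_imageDomain hh hδ (by rw [Prod.snd_add]; omega)
      (by rw [Prod.snd_add]; omega)) hq

lemma fillValue_eq_sum (s : Scheme) (g : ℝ × ℝ) (μ : ℝ) (hh : h * N = 1) (hδ : r * h < δ)
    {S : State d} (hS : S.region = rowsAbove N k) (hp : p.2 = k + 1) (hpN : p.2 ≤ N) :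
    fillValue (imageDomain δ) h (neighbourhood s (imageDomain δ) g h (r * h))
        (weight μ g (r * h)) S (pos h p)
      = ∑ q ∈ stencilBox r, stencilWeight s g μ r q • S.image (p + q) := by
  have h_pos := pixelWidth_pos hh
  have injective : Function.Injective fun y : ℝ × ℝ => pos h p + h • y :=
    (add_right_injective _).comp (smul_right_injective _ h_pos.ne')
  have finite := finite_halfBall s g r
  rw [fillValue, hS, readable_neighbours s g hh hδ hp hpN, finsum_mem_image injective.injOn,
    finsum_mem_image injective.injOn, finsum_mem_eq_finite_toFinset_sum _ finite,
    finsum_mem_eq_finite_toFinset_sum _ finite]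
  simp only [weight_smul μ g _ h_pos]
  calc finite.toFinset.centerMass (h⁻¹ • weight μ g r 0)
        (fun y => interpolate (imageDomain δ) h S.image (pos h p + h • y))
      = finite.toFinset.centerMass (weight μ g r 0)
        (fun y => ∑ q ∈ stencilBox r, bilinearBasis 1 q y • S.image (p + q)) := by
        rw [Finset.centerMass_smul_left (hc := inv_ne_zero h_pos.ne'), Finset.centerMass,
          Finset.centerMass]
        refine congrArg _ (Finset.sum_congr rfl fun y hy => ?_)
        rw [interpolate_eq_sum hh hδ (by omega) hpN _
          (halfBall_subset_stencilHull s g r (finite.mem_toFinset.1 hy))]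
    _ = ∑ q ∈ stencilBox r, stencilWeight s g μ r q • S.image (p + q) :=
        (sum_centerMass_smul _ _ _ (fun y q => bilinearBasis 1 q y) _).symm

variable {s : Scheme} {u₀ : ℝ × ℝ → Fin d → ℝ} {g : ℝ × ℝ} {μ : ℝ}

lemma stateAfter_succ :
    stateAfter s δ u₀ g μ r h (k + 1)
      = fillShell (imageDomain δ) h (neighbourhood s (imageDomain δ) g h (r * h))
        (weight μ g (r * h)) (stateAfter s δ u₀ g μ r h k) :=
  Function.iterate_succ_apply' _ _ _

lemma region_stateAfter (hh : h * N = 1) (hδ : r * h < δ) (k : ℕ) :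
    (stateAfter s δ u₀ g μ r h k).region = rowsAbove N k := by
  induction k with
  | zero => exact pixelsIn_inpaintingDomain hh
  | succ k ih =>
    rw [stateAfter_succ, fillShell, ih, activeBoundary_rowsAbove hh hδ]
    ext q
    simp only [rowsAbove, Set.mem_sdiff, Set.mem_ofPred_eq]
    omega

lemma image_stateAfter_eq (hh : h * N = 1) (hδ : r * h < δ) {l : ℕ} (hkl : k ≤ l)
    (hp : p.2 ≤ k) :
    (stateAfter s δ u₀ g μ r h l).image p = (stateAfter s δ u₀ g μ r h k).image p := by
  induction l, hkl using Nat.le_induction with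
  | base => rfl
  | succ l hkl ih =>
    rw [← ih, stateAfter_succ, fillShell, region_stateAfter hh hδ, activeBoundary_rowsAbove hh hδ]
    exact if_neg fun hmem => by
      have := hmem.1
      omega

lemma image_stateAfter_succ (hh : h * N = 1) (hδ : r * h < δ) (hp : p.2 = k + 1)
    (hpN : p.2 ≤ N) :
    (stateAfter s δ u₀ g μ r h (k + 1)).image p
      = ∑ q ∈ stencilBox r, stencilWeight s g μ r q •
        (stateAfter s δ u₀ g μ r h k).image (p + q) := by
  have region_eq := region_stateAfter (s := s) (u₀ := u₀) (g := g) (μ := μ) hh hδ k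
  rw [stateAfter_succ, fillShell, region_eq, activeBoundary_rowsAbove hh hδ]
  exact (if_pos ⟨hp, hpN⟩).trans (fillValue_eq_sum s g μ hh hδ region_eq hp hpN)

lemma isStencilExtension_stateAfter (hh : h * N = 1) (hδ : r * h < δ) :
    IsStencilExtension r (stencilWeight s g μ r) N (fun p => u₀ (pos h p))
      (stateAfter s δ u₀ g μ r h N).image where
  boundary p hp := by
    rw [image_stateAfter_eq hh hδ N.zero_le hp]
    refine if_neg fun hmem => ?_
    rw [pixelsIn_inpaintingDomain hh] at hmem
    exact hp.not_gt hmem.1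
  average p hp hpN := by
    obtain ⟨k, hk⟩ : ∃ k : ℕ, p.2 = k + 1 := ⟨(p.2 - 1).toNat, by omega⟩
    have hkN : k + 1 ≤ N := by omega
    rw [image_stateAfter_eq hh hδ hkN (by omega), image_stateAfter_succ hh hδ hk hpN]
    refine Finset.sum_congr rfl fun q hq => ?_
    have hq₂ := (mem_stencilBox.1 hq).2.2
    rw [image_stateAfter_eq hh hδ (Nat.le_of_succ_le hkN) (by rw [Prod.snd_add]; omega)]

lemma exists_region_eq_empty (s : Scheme) (u₀ : ℝ × ℝ → Fin d → ℝ) (g : ℝ × ℝ) (μ : ℝ)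
    (hh : h * N = 1) (hδ : r * h < δ) : ∃ k, (stateAfter s δ u₀ g μ r h k).region = ∅ :=
  ⟨N, by rw [region_stateAfter hh hδ, rowsAbove_eq_empty_iff]⟩

lemma isStencilExtension_inpainted (s : Scheme) (u₀ : ℝ × ℝ → Fin d → ℝ) (g : ℝ × ℝ) (μ : ℝ)
    (hh : h * N = 1) (hδ : r * h < δ) :
    IsStencilExtension r (stencilWeight s g μ r) N (fun p => u₀ (pos h p))
      (inpainted s δ u₀ g μ r h) := by
  have stops : sInf {k | (stateAfter s δ u₀ g μ r h k).region = ∅} = N := by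
    simp only [region_stateAfter hh hδ, rowsAbove_eq_empty_iff]
    exact csInf_Ici
  rw [inpainted, stops]
  exact isStencilExtension_stateAfter hh hδ

end Algorithm

/-! ### Boundary data -/

section BoundaryData

open Filter Topology

variable {d n : ℕ} {δ : ℝ} {u₀ : ℝ × ℝ → Fin d → ℝ} {C : Fin n → JumpCurve δ}

/-- Monotonicity confines the part of the curve close to the line `y = 0` to a neighbourhood of the
point where the curve meets the line. -/
lemma JumpCurve.exists_cone (γ : JumpCurve δ) :
    ∃ a κ : ℝ, 0 ≤ κ ∧ ∀ᶠ y in 𝓝 0, ∀ x ∈ γ.interval, γ.f x = y → |x - a| ≤ κ * |y| := by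
  obtain ⟨a, ha, hfa, slope_pos⟩ := γ.meets
  have hder : HasDerivWithinAt γ.f (derivWithin γ.f γ.interval a) γ.interval a :=
    (differentiableWithinAt_of_derivWithin_ne_zero slope_pos.ne').hasDerivWithinAt
  obtain ⟨κ, hκ, hbound⟩ := (hder.isTheta_sub slope_pos.ne').isBigO_symm.exists_pos
  have linear := hbound.bound
  rw [prod_pure, eventually_map, eventually_nhdsWithin_iff] at linear
  obtain ⟨τ, hτ, near⟩ := Metric.eventually_nhds_iff.1 linear
  have near_cone : ∀ x ∈ γ.interval, |x - a| < τ → |x - a| ≤ κ * |γ.f x| := fun x hx hxa => by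
    simpa only [hfa, sub_zero, Real.norm_eq_abs] using near (by rwa [Real.dist_eq]) hx
  have height_le : ∀ x ∈ γ.interval, ∀ t ∈ Set.uIcc a x, |γ.f t| ≤ |γ.f x| := by
    intro x hx t ht
    have hti : t ∈ γ.interval := γ.ordConnected.uIcc_subset ha hx ht
    rw [abs_of_nonpos (γ.mapsTo hti).2, abs_of_nonpos (γ.mapsTo hx).2, neg_le_neg_iff]
    rcases Set.mem_uIcc.1 ht with ⟨hat, -⟩ | ⟨hxt, -⟩
    · exact (γ.mapsTo hx).2.trans (hfa ▸ γ.monotone ha hti hat)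
    · exact γ.monotone hx hti hxt
  have far : ∀ x ∈ γ.interval, τ ≤ |x - a| → τ / 2 ≤ κ * |γ.f x| := by
    intro x hx hxa
    obtain ⟨t, ht, hta⟩ : ∃ t ∈ Set.uIcc a x, |t - a| = τ / 2 := by
      rcases le_abs.1 hxa with h | h
      · exact ⟨a + τ / 2, Set.mem_uIcc_of_le (by linarith) (by linarith),
          by rw [add_sub_cancel_left, abs_of_pos (half_pos hτ)]⟩
      · exact ⟨a - τ / 2, Set.mem_uIcc_of_ge (by linarith) (by linarith),
          by rw [sub_sub_cancel_left, abs_neg, abs_of_pos (half_pos hτ)]⟩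
    rw [← hta]
    exact (near_cone t (γ.ordConnected.uIcc_subset ha hx ht) (by linarith)).trans
      (mul_le_mul_of_nonneg_left (height_le x hx t ht) hκ.le)
  refine ⟨a, κ, hκ.le, Metric.eventually_nhds_iff.2 ⟨τ / (2 * κ), by positivity, ?_⟩⟩
  rintro y hy x hx rfl
  rw [Real.dist_0_eq_abs, lt_div_iff₀ (by positivity)] at hy
  exact near_cone x hx (not_le.1 fun hxa => by linarith [far x hx hxa])

lemma exists_jump_cones (C : Fin n → JumpCurve δ) (B : ℝ) :
    ∃ (T : Finset ℝ) (κ : ℝ), 0 ≤ κ ∧ ∀ᶠ y in 𝓝 0, ∀ x ∈ Set.Icc (-B) B,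
      (x, y) ∈ jumpSet C → ∃ a ∈ T, |x - a| ≤ κ * |y| := by
  choose a κ hκ cone using fun i => (C i).exists_cone
  have κ_le (i) : κ i ≤ ∑ j, κ j :=
    Finset.single_le_sum (f := κ) (fun j _ => hκ j) (Finset.mem_univ i)
  have κ_nonneg : 0 ≤ ∑ j, κ j := Finset.sum_nonneg fun j _ => hκ j
  have a_le (i) : |a i| ≤ ∑ j, |a j| :=
    Finset.single_le_sum (f := fun j => |a j|) (fun j _ => abs_nonneg _) (Finset.mem_univ i)
  let R : ℤ := ⌈B + ∑ j, κ j + ∑ j, |a j|⌉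
  refine ⟨(Finset.univ ×ˢ Finset.Icc (-R) R).image fun im => a im.1 + (im.2 : ℝ), ∑ j, κ j,
    κ_nonneg, ?_⟩
  filter_upwards [eventually_all.2 cone, Metric.ball_mem_nhds 0 one_pos] with y hcone hy
  rintro x hx ⟨i, t, ht, m, hm⟩
  obtain ⟨rfl, rfl⟩ := Prod.mk.inj hm
  rw [mem_ball_zero_iff, Real.norm_eq_abs] at hy
  have in_cone : |t - a i| ≤ (∑ j, κ j) * |(C i).f t| :=
    (hcone i t ht rfl).trans (mul_le_mul_of_nonneg_right (κ_le i) (abs_nonneg _))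
  refine ⟨a i + m, Finset.mem_image.2 ⟨(i, m), ?_, rfl⟩, by rwa [add_sub_add_right_eq_sub]⟩
  have m_le : |(m : ℝ)| ≤ R := by
    refine le_trans ?_ (Int.le_ceil _)
    have t_near := in_cone.trans (mul_le_of_le_one_right κ_nonneg hy.le)
    have apex_le := a_le i
    rw [abs_le] at t_near apex_le ⊢
    constructor <;> linarith [hx.1, hx.2]
  rw [abs_le] at m_le
  simp only [Finset.mem_product, Finset.mem_univ, true_and, Finset.mem_Icc]
  exact_mod_cast m_le

/-- A rectangle in the undamaged region, with one side on the boundary of the inpainting domain. -/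
def undamagedBox (B b : ℝ) : Set (ℝ × ℝ) := Set.Icc (-B) B ×ˢ Set.Icc (-b) 0

lemma undamagedBox_subset_undamaged {b : ℝ} (hb : b < δ) (B : ℝ) :
    undamagedBox B b ⊆ undamaged δ :=
  fun _ hz => ⟨by linarith [hz.2.1], hz.2.2⟩

namespace IsPiecewiseC2

variable {Q : Set (ℝ × ℝ)} {B b M x x' y : ℝ} {z w : ℝ × ℝ}

lemma exists_bound (hu : IsPiecewiseC2 δ u₀ C) (hQ : IsCompact Q) (hQδ : Q ⊆ undamaged δ) :
    ∃ M, 0 ≤ M ∧ ∀ z ∈ Q, ‖u₀ z‖ ≤ M ∧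
      (z ∉ jumpSet C → ‖fderivWithin ℝ u₀ (undamaged δ \ jumpSet C) z‖ ≤ M) := by
  let BoundedBy (M : ℝ) (s : Set (ℝ × ℝ)) : Prop := ∀ z ∈ s, ‖u₀ z‖ ≤ M ∧
    (z ∉ jumpSet C → ‖fderivWithin ℝ u₀ (undamaged δ \ jumpSet C) z‖ ≤ M)
  have mono {M M' : ℝ} {s : Set (ℝ × ℝ)} (hs : BoundedBy M s) (hM : M ≤ M') : BoundedBy M' s :=
    fun z hz => ⟨(hs z hz).1.trans hM, fun hj => ((hs z hz).2 hj).trans hM⟩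
  obtain ⟨M, hM⟩ : ∃ M, BoundedBy M Q := by
    refine hQ.induction_on ⟨0, fun _ hz => hz.elim⟩ ?_ ?_ fun z hz => ?_
    · exact fun s t hst ⟨M, hM⟩ => ⟨M, fun z hz => hM z (hst hz)⟩
    · exact fun s t ⟨M, hM⟩ ⟨M', hM'⟩ => ⟨max M M', fun z hz =>
        hz.elim (mono hM (le_max_left _ _) z) (mono hM' (le_max_right _ _) z)⟩
    · obtain ⟨M, hM⟩ := hu.locallyBounded z (hQδ hz)
      exact ⟨_, nhdsWithin_mono z hQδ hM, M, fun w hw => hw⟩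
  exact ⟨max M 0, le_max_right _ _, mono hM (le_max_left _ _)⟩

lemma norm_sub_le_of_segment (hu : IsPiecewiseC2 δ u₀ C) (hQ : Convex ℝ Q)
    (hQδ : Q ⊆ undamaged δ) (hM : ∀ z ∈ Q, z ∉ jumpSet C →
      ‖fderivWithin ℝ u₀ (undamaged δ \ jumpSet C) z‖ ≤ M)
    (hz : z ∈ Q) (hw : w ∈ Q) (avoids : ∀ p ∈ segment ℝ z w, p ∉ jumpSet C) :
    ‖u₀ z - u₀ w‖ ≤ M * ‖z - w‖ := by
  have inside : segment ℝ z w ⊆ Q := hQ.segment_subset hz hw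
  have smooth : segment ℝ z w ⊆ undamaged δ \ jumpSet C := fun p hp =>
    ⟨hQδ (inside hp), avoids p hp⟩
  exact (convex_segment z w).norm_image_sub_le_of_norm_hasFDerivWithin_le
    (fun p hp => ((hu.contDiffOn.differentiableOn two_ne_zero p
      (smooth hp)).hasFDerivWithinAt).mono smooth)
    (fun p hp => hM p (inside hp) (avoids p hp)) (right_mem_segment ..) (left_mem_segment ..)

lemma norm_sub_le_of_path (hu : IsPiecewiseC2 δ u₀ C) (hb : b < δ)
    (hM : ∀ z ∈ undamagedBox B b, z ∉ jumpSet C →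
      ‖fderivWithin ℝ u₀ (undamaged δ \ jumpSet C) z‖ ≤ M)
    (hz : (x, y) ∈ undamagedBox B b) (hx' : x' ∈ Set.Icc (-B) B)
    (avoids_vertical : ∀ t ∈ Set.Icc y 0, (x, t) ∉ jumpSet C)
    (avoids_horizontal : ∀ t ∈ Set.uIcc x x', (t, (0 : ℝ)) ∉ jumpSet C) :
    ‖u₀ (x, y) - u₀ (x', 0)‖ ≤ M * (|y| + |x - x'|) := by
  have hQ : Convex ℝ (undamagedBox B b) := (convex_Icc _ _).prod (convex_Icc _ _)
  have hQδ := undamagedBox_subset_undamaged hb B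
  have zero_mem : (0 : ℝ) ∈ Set.Icc (-b) 0 := ⟨hz.2.1.trans hz.2.2, le_rfl⟩
  have vertical : ‖u₀ (x, y) - u₀ (x, 0)‖ ≤ M * |y| := by
    have := hu.norm_sub_le_of_segment hQ hQδ hM hz (w := (x, 0)) ⟨hz.1, zero_mem⟩ fun p hp => by
      rw [← Prod.image_mk_segment_right, segment_eq_Icc hz.2.2] at hp
      obtain ⟨t, ht, rfl⟩ := hp
      exact avoids_vertical t ht
    simpa [Prod.norm_def] using this
  have horizontal : ‖u₀ (x, 0) - u₀ (x', 0)‖ ≤ M * |x - x'| := by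
    have := hu.norm_sub_le_of_segment hQ hQδ hM (z := (x, 0)) (w := (x', 0)) ⟨hz.1, zero_mem⟩
      ⟨hx', zero_mem⟩ fun p hp => by
        rw [← Prod.image_mk_segment_left, segment_eq_uIcc] at hp
        obtain ⟨t, ht, rfl⟩ := hp
        exact avoids_horizontal t ht
    simpa [Prod.norm_def] using this
  calc ‖u₀ (x, y) - u₀ (x', 0)‖
      ≤ ‖u₀ (x, y) - u₀ (x, 0)‖ + ‖u₀ (x, 0) - u₀ (x', 0)‖ := norm_sub_le_norm_sub_add_norm_sub ..
    _ ≤ M * (|y| + |x - x'|) := by linarith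

lemma eventually_lipschitz_or_jump (hu : IsPiecewiseC2 δ u₀ C) (hb : b < δ)
    (hM : ∀ z ∈ undamagedBox B b, z ∉ jumpSet C →
      ‖fderivWithin ℝ u₀ (undamaged δ \ jumpSet C) z‖ ≤ M) :
    ∃ (T : Finset ℝ) (κ : ℝ), 0 ≤ κ ∧ ∀ᶠ y in 𝓝 0, ∀ x, (x, y) ∈ undamagedBox B b →
      ∀ x' ∈ Set.Icc (-B) B, ‖u₀ (x, y) - u₀ (x', 0)‖ ≤ M * (|y| + |x - x'|) ∨
        ∃ a ∈ T, |x' - a| ≤ |x - x'| + κ * |y| := by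
  obtain ⟨T, κ, hκ, cones⟩ := exists_jump_cones C B
  obtain ⟨η, hη, cones⟩ := Metric.eventually_nhds_iff.1 cones
  refine ⟨T, κ, hκ, Metric.eventually_nhds_iff.2 ⟨η, hη, fun y hy x hz x' hx' => ?_⟩⟩
  rw [Real.dist_0_eq_abs] at hy
  rw [or_iff_not_imp_right]
  intro no_jump
  push Not at no_jump
  refine hu.norm_sub_le_of_path hb hM hz hx' (fun t ht hj => ?_) fun t ht hj => ?_
  · have t_le : |t| ≤ |y| := by rw [abs_of_nonpos ht.2, abs_of_nonpos hz.2.2]; linarith [ht.1]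
    obtain ⟨a, ha, hxa⟩ := cones (by rw [Real.dist_0_eq_abs]; linarith) x hz.1 hj
    have triangle := abs_sub_le x' x a
    rw [abs_sub_comm x' x] at triangle
    linarith [no_jump a ha, mul_le_mul_of_nonneg_left t_le hκ]
  · obtain ⟨a, ha, hta⟩ := cones (by rwa [dist_self]) t (Set.uIcc_subset_Icc hz.1 hx' ht) hj
    rw [abs_zero, mul_zero] at hta
    have triangle := abs_sub_le x' t a
    have between := Set.abs_sub_right_of_mem_uIcc ht
    rw [abs_sub_comm x' x] at between
    linarith [no_jump a ha, mul_nonneg hκ (abs_nonneg y), abs_sub_comm x' t]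

lemma exists_lipschitz_or_jump (hu : IsPiecewiseC2 δ u₀ C) (hb : b < δ) (B : ℝ) :
    ∃ (T : Finset ℝ) (κ M : ℝ), 0 ≤ κ ∧ 0 ≤ M ∧ (∀ z ∈ undamagedBox B b, ‖u₀ z‖ ≤ M) ∧
      ∀ x y, (x, y) ∈ undamagedBox B b → ∀ x' ∈ Set.Icc (-B) B,
        ‖u₀ (x, y) - u₀ (x', 0)‖ ≤ M * (|y| + |x - x'|) ∨
        ∃ a ∈ T, |x' - a| ≤ |x - x'| + κ * |y| := by
  obtain ⟨M, hM, bound⟩ := hu.exists_bound (isCompact_Icc.prod isCompact_Icc)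
    (undamagedBox_subset_undamaged hb B)
  obtain ⟨T, κ, hκ, near⟩ := hu.eventually_lipschitz_or_jump hb fun z hz => (bound z hz).2
  obtain ⟨η, hη, near⟩ := Metric.eventually_nhds_iff.1 near
  have hMη : M ≤ M + 2 * M / η := le_add_of_nonneg_right (by positivity)
  refine ⟨T, κ, M + 2 * M / η, hκ, by positivity, fun z hz => (bound z hz).1.trans hMη,
    fun x y hz x' hx' => ?_⟩
  rcases lt_or_ge |y| η with hy | hy
  · refine (near (by rwa [Real.dist_0_eq_abs]) x hz x' hx').imp_left fun h => h.trans ?_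
    exact mul_le_mul_of_nonneg_right hMη (by positivity)
  · have hx'Q : (x', 0) ∈ undamagedBox B b := ⟨hx', hz.2.1.trans hz.2.2, le_rfl⟩
    left
    calc ‖u₀ (x, y) - u₀ (x', 0)‖
        ≤ 2 * M := by linarith [norm_sub_le (u₀ (x, y)) (u₀ (x', 0)), (bound _ hz).1,
          (bound _ hx'Q).1]
      _ = 2 * M / η * η := (div_mul_cancel₀ _ hη.ne').symm
      _ ≤ (M + 2 * M / η) * (|y| + |x - x'|) := by
        gcongr
        · linarith
        · linarith [abs_nonneg (x - x')]

lemma contDiff_trace (hδ : 0 < δ) {C : Fin 0 → JumpCurve δ} (hu : IsPiecewiseC2 δ u₀ C) :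
    ContDiff ℝ 2 fun x : ℝ => u₀ (x, 0) := by
  rw [← contDiffOn_univ]
  refine hu.contDiffOn.comp (f := fun x : ℝ => (x, (0 : ℝ)))
    (contDiff_id.prodMk contDiff_const).contDiffOn fun x _ => ⟨⟨neg_lt_zero.2 hδ, le_rfl⟩, ?_⟩
  rintro ⟨i, -⟩
  exact i.elim0

end IsPiecewiseC2

lemma exists_taylor_bound {E : Type*} [NormedAddCommGroup E] [NormedSpace ℝ E] {φ : ℝ → E}
    (hφ : ContDiff ℝ 2 φ) (B : ℝ) :
    ∃ K : ℝ, 0 ≤ K ∧ ∀ x' ∈ Set.Icc (-B) B, ‖deriv φ x'‖ ≤ K ∧ ∀ x ∈ Set.Icc (-B) B,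
      ‖φ x - φ x' - (x - x') • deriv φ x'‖ ≤ K * (x - x') ^ 2 := by
  have hφ' : ContDiff ℝ 1 (deriv φ) := by
    have : ContDiff ℝ (1 + 1) φ := by rwa [one_add_one_eq_two]
    exact (contDiff_succ_iff_deriv.1 this).2.2
  obtain ⟨K₁, hK₁⟩ := (isCompact_Icc (a := -B) (b := B)).exists_bound_of_continuousOn
    hφ'.continuous.continuousOn
  obtain ⟨K₂, hK₂⟩ := (isCompact_Icc (a := -B) (b := B)).exists_bound_of_continuousOn
    (hφ'.continuous_deriv le_rfl).continuousOn
  refine ⟨max 0 (max K₁ K₂), le_max_left _ _, fun x' hx' =>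
    ⟨(hK₁ x' hx').trans ((le_max_left _ _).trans (le_max_right _ _)), fun x hx => ?_⟩⟩
  set K := max 0 (max K₁ K₂)
  have deriv_sub_le : ∀ t ∈ Set.uIcc x' x, ‖deriv φ t - deriv φ x'‖ ≤ K * |x - x'| := by
    intro t ht
    calc ‖deriv φ t - deriv φ x'‖ ≤ K * ‖t - x'‖ :=
          (convex_Icc (-B) B).norm_image_sub_le_of_norm_deriv_le
            (fun s _ => hφ'.differentiable one_ne_zero s)
            (fun s hs => (hK₂ s hs).trans ((le_max_right _ _).trans (le_max_right _ _)))
            hx' (Set.uIcc_subset_Icc hx' hx ht)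
      _ ≤ K * |x - x'| :=
          mul_le_mul_of_nonneg_left (Set.abs_sub_left_of_mem_uIcc ht) (le_max_left _ _)
  have remainder_le := (convex_uIcc x' x).norm_image_sub_le_of_norm_hasDerivWithin_le
    (f := fun t => φ t - t • deriv φ x') (f' := fun t => deriv φ t - deriv φ x')
    (fun t _ => (((hφ.differentiable two_ne_zero t).hasDerivAt.sub
      ((hasDerivAt_id t).smul_const _)).congr_deriv (by rw [one_smul])).hasDerivWithinAt)
    deriv_sub_le Set.left_mem_uIcc Set.right_mem_uIcc
  calc ‖φ x - φ x' - (x - x') • deriv φ x'‖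
      = ‖φ x - x • deriv φ x' - (φ x' - x' • deriv φ x')‖ := by rw [sub_smul]; congr 1; abel
    _ ≤ K * |x - x'| * ‖x - x'‖ := remainder_le
    _ = K * (x - x') ^ 2 := by rw [Real.norm_eq_abs, mul_assoc, abs_mul_abs_self, sq]

end BoundaryData

/-! ### Pointwise errors -/

section Pointwise

/-- A smeared indicator of the points within distance `√h` of the jumps `T` of the trace. -/
noncomputable def jumpProximity (T : Finset ℝ) (h x : ℝ) : ℝ := ∑ a ∈ T, h / ((x - a) ^ 2 + h)

variable {h P ζ : ℝ}

lemma jumpProximity_nonneg (T : Finset ℝ) (hh : 0 ≤ h) (x : ℝ) : 0 ≤ jumpProximity T h x :=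
  Finset.sum_nonneg fun _ _ => by positivity

lemma abs_add_le_barrier (hP : 0 ≤ P) (h_pos : 0 < h) (h_le : h ≤ 1) (ζ : ℝ) :
    |ζ| + P * h ≤ (1 + P) * (√h / h * (h + ζ ^ 2)) := by
  have sq_sqrt : √h ^ 2 = h := Real.sq_sqrt h_pos.le
  have sqrt_pos : 0 < √h := Real.sqrt_pos.2 h_pos
  have sqrt_le : √h ≤ 1 := Real.sqrt_le_one.2 h_le
  have rescale : √h * (√h / h * (h + ζ ^ 2)) = h + ζ ^ 2 := by
    rw [← mul_assoc, mul_div_assoc', ← sq, sq_sqrt, div_self h_pos.ne', one_mul]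
  refine le_of_mul_le_mul_left ?_ sqrt_pos
  calc √h * (|ζ| + P * h) = √h * |ζ| + P * (√h * h) := by ring
    _ ≤ (h + ζ ^ 2) + P * (h + ζ ^ 2) := by
        gcongr
        · nlinarith [sq_nonneg (√h - |ζ|), sq_abs ζ]
        · exact (mul_le_of_le_one_left h_pos.le sqrt_le).trans
            (le_add_of_nonneg_right (sq_nonneg ζ))
    _ = √h * ((1 + P) * (√h / h * (h + ζ ^ 2))) := by rw [mul_left_comm, rescale]; ring

lemma sq_add_le_barrier {t : ℝ} (h_pos : 0 < h) (h_le : h ≤ 1) (ht : |t| ≤ |ζ| + P * h) :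
    t ^ 2 + h ≤ (2 + 2 * P ^ 2) * (h + ζ ^ 2) := by
  have sq_le : P ^ 2 * h ^ 2 ≤ P ^ 2 * h := by
    gcongr; exact pow_le_of_le_one h_pos.le h_le two_ne_zero
  calc t ^ 2 + h ≤ (|ζ| + P * h) ^ 2 + h := by rw [← sq_abs]; gcongr
    _ ≤ 2 * (|ζ| ^ 2 + (P * h) ^ 2) + h := by gcongr; exact add_sq_le
    _ ≤ (2 + 2 * P ^ 2) * (h + ζ ^ 2) := by
        rw [sq_abs, mul_pow]
        linarith [mul_nonneg (sq_nonneg P) (sq_nonneg ζ)]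

lemma one_le_barrier {T : Finset ℝ} {a x : ℝ} (h_pos : 0 < h) (h_le : h ≤ 1)
    (ha : a ∈ T) (near : |x - a| ≤ |ζ| + P * h) :
    1 ≤ (2 + 2 * P ^ 2) * (jumpProximity T h x / h * (h + ζ ^ 2)) := by
  calc 1 ≤ (2 + 2 * P ^ 2) * (h + ζ ^ 2) / ((x - a) ^ 2 + h) :=
        (one_le_div (by positivity)).2 (sq_add_le_barrier h_pos h_le near)
    _ = (2 + 2 * P ^ 2) * (h / ((x - a) ^ 2 + h) / h * (h + ζ ^ 2)) := by field_simp
    _ ≤ (2 + 2 * P ^ 2) * (jumpProximity T h x / h * (h + ζ ^ 2)) := by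
        gcongr
        exact Finset.single_le_sum (f := fun a => h / ((x - a) ^ 2 + h))
          (fun _ _ => by positivity) ha

variable {d n r N : ℕ} {δ B b m : ℝ} {u₀ : ℝ × ℝ → Fin d → ℝ} {C : Fin n → JumpCurve δ}
  {p p₀ : ℤ × ℤ}

lemma pixelWidth_le_one (hh : h * N = 1) : h ≤ 1 := by
  have N_pos : N ≠ 0 := by rintro rfl; simp at hh
  calc h ≤ h * N := le_mul_of_one_le_right (pixelWidth_pos hh).le
        (mod_cast Nat.one_le_iff_ne_zero.2 N_pos)
    _ = 1 := hh

lemma abs_mul_le_of_abs_le {y : ℝ} (hm : |m| ≤ r) (hy : |y| ≤ r * h) : |m * y| ≤ r ^ 2 * h := by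
  calc |m * y| = |m| * |y| := abs_mul _ _
    _ ≤ r * (r * h) := by gcongr
    _ = r ^ 2 * h := by ring

lemma abs_fst_sub_le {z : ℝ × ℝ} (hm : |m| ≤ r) (hz : |z.2| ≤ r * h) (x : ℝ) :
    |z.1 - x| ≤ |foot m z - x| + r ^ 2 * h := by
  calc |z.1 - x| = |foot m z - x + m * z.2| := by rw [foot]; ring_nf
    _ ≤ |foot m z - x| + r ^ 2 * h :=
        (abs_add_le _ _).trans (add_le_add_right (abs_mul_le_of_abs_le hm hz) _)

lemma snd_pos_mem_Icc (h_pos : 0 < h) (hp : p ∈ dependenceCone r p₀) (hp₂ : p.2 ≤ 0) :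
    (pos h p).2 ∈ Set.Icc (-((r - 1) * h)) 0 := by
  have depth : -(r - 1 : ℝ) ≤ p.2 := mod_cast (by linarith [hp.1] : -((r : ℤ) - 1) ≤ p.2)
  have height : (p.2 : ℝ) ≤ 0 := mod_cast hp₂
  exact ⟨by rw [← neg_mul]; exact mul_le_mul_of_nonneg_right depth h_pos.le,
    mul_nonpos_of_nonpos_of_nonneg height h_pos.le⟩

lemma abs_snd_pos_le (h_pos : 0 < h) (hp : p ∈ dependenceCone r p₀) (hp₂ : p.2 ≤ 0) :
    |(pos h p).2| ≤ r * h := by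
  obtain ⟨depth, height⟩ := snd_pos_mem_Icc h_pos hp hp₂
  rw [abs_of_nonpos height]
  linarith

lemma abs_fst_pos_le (hh : h * N = 1) (hp₀ : p₀ ∈ pixelGrid N) (hp : p ∈ dependenceCone r p₀) :
    |(pos h p).1| ≤ 1 + r + r ^ 2 := by
  simp only [pixelGrid, Finset.mem_product, Finset.mem_Icc] at hp₀
  have h_pos := pixelWidth_pos hh
  have spread : |(p.1 : ℝ) - p₀.1| ≤ r * (N + r) := by
    have : |p.1 - p₀.1| ≤ r * (N + r) :=
      hp.2.2.trans (mul_le_mul_of_nonneg_left (by linarith [hp.1]) (by omega))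
    exact_mod_cast this
  have centre : |(p₀.1 : ℝ)| ≤ N := mod_cast abs_le.2 ⟨by omega, hp₀.1.2⟩
  calc |p.1 * h| = |(p.1 - p₀.1 : ℝ) + p₀.1| * h := by
        rw [sub_add_cancel, abs_mul, abs_of_pos h_pos]
    _ ≤ (r * (N + r) + N) * h := by
        gcongr
        exact (abs_add_le _ _).trans (add_le_add spread centre)
    _ = 1 + r + r ^ 2 * h := by linear_combination (1 + (r : ℝ)) * hh
    _ ≤ 1 + r + r ^ 2 := by
        gcongr
        exact mul_le_of_le_one_right (by positivity) (pixelWidth_le_one hh)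

lemma pos_mem_undamagedBox (hr : 1 ≤ r) (hh : h * N = 1) (hδ : r * h < δ)
    (hp₀ : p₀ ∈ pixelGrid N) (hp : p ∈ dependenceCone r p₀) (hp₂ : p.2 ≤ 0) :
    pos h p ∈ undamagedBox (1 + r + r ^ 2) (δ - δ / r) := by
  obtain ⟨depth, height⟩ := snd_pos_mem_Icc (pixelWidth_pos hh) hp hp₂
  refine ⟨abs_le.1 (abs_fst_pos_le hh hp₀ hp), (neg_le_neg ?_).trans depth, height⟩
  have r_pos : (0 : ℝ) < r := mod_cast hr
  calc (r - 1) * h ≤ (r - 1) * (δ / r) := by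
        gcongr
        · exact sub_nonneg.2 (mod_cast hr)
        · exact (le_div_iff₀' r_pos).2 hδ.le
    _ = δ - δ / r := by field_simp

lemma foot_pos_mem_Icc (hm : |m| ≤ r) (hh : h * N = 1) (hp₀ : p₀ ∈ pixelGrid N) :
    foot m (pos h p₀) ∈ Set.Icc (-(1 + r + r ^ 2 : ℝ)) (1 + r + r ^ 2) := by
  simp only [pixelGrid, Finset.mem_product, Finset.mem_Icc] at hp₀
  have unit {k : ℤ} (hk : 1 ≤ k ∧ k ≤ N) : |k * h| ≤ 1 := by
    have hk₀ : (0 : ℝ) ≤ k := mod_cast zero_le_one.trans hk.1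
    have hkN : (k : ℝ) ≤ N := mod_cast hk.2
    have h_nonneg := (pixelWidth_pos hh).le
    rw [abs_of_nonneg (mul_nonneg hk₀ h_nonneg), mul_comm, ← hh]
    gcongr
  refine Set.mem_Icc.2 (abs_le.1 ?_)
  calc |p₀.1 * h - m * (p₀.2 * h)| ≤ |p₀.1 * h| + |m| * |p₀.2 * h| := by
        rw [← abs_mul]; exact abs_sub _ _
    _ ≤ 1 + r * 1 := by gcongr; exacts [unit hp₀.1, unit hp₀.2]
    _ ≤ 1 + r + r ^ 2 := by linarith [sq_nonneg (r : ℝ)]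

namespace IsPiecewiseC2

lemma exists_boundary_bound (hu : IsPiecewiseC2 δ u₀ C) (hb : b < δ) (B : ℝ) (r : ℕ) :
    ∃ (T : Finset ℝ) (A : ℝ), 0 ≤ A ∧ (∀ z ∈ undamagedBox B b, ‖u₀ z‖ ≤ A) ∧
      ∀ h m : ℝ, 0 < h → h ≤ 1 → |m| ≤ r → ∀ z ∈ undamagedBox B b, |z.2| ≤ r * h →
        ∀ x ∈ Set.Icc (-B) B, ‖u₀ z - u₀ (x, 0)‖
          ≤ A * (√h + jumpProximity T h x) / h * (h + (foot m z - x) ^ 2) := by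
  obtain ⟨T, κ, M, hκ, hM, bound, lipschitz_or_jump⟩ := hu.exists_lipschitz_or_jump hb B
  let P : ℝ := r ^ 2 + κ * r
  let A₁ : ℝ := M * (1 + (r + r ^ 2))
  let A₂ : ℝ := 2 * M * (2 + 2 * P ^ 2)
  have hA₁ : 0 ≤ A₁ := by positivity
  have hA₂ : 0 ≤ A₂ := by positivity
  have hMA : M ≤ A₁ + A₂ :=
    (le_mul_of_one_le_right hM (by linarith [sq_nonneg (r : ℝ), r.cast_nonneg (α := ℝ)])).trans
      (le_add_of_nonneg_right hA₂)
  refine ⟨T, A₁ + A₂, by positivity, fun z hz => (bound z hz).trans hMA,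
    fun h m h_pos h_le hm z hz height x hx => ?_⟩
  set ζ := foot m z - x
  have shift : |z.1 - x| ≤ |ζ| + r ^ 2 * h := abs_fst_sub_le hm height x
  have hS := jumpProximity_nonneg T h_pos.le x
  rcases lipschitz_or_jump z.1 z.2 hz x hx with lipschitz | ⟨a, ha, jump⟩
  · calc ‖u₀ z - u₀ (x, 0)‖ ≤ M * (r * h + (|ζ| + r ^ 2 * h)) := lipschitz.trans (by gcongr)
      _ = M * (|ζ| + (r + r ^ 2) * h) := by ring
      _ ≤ M * ((1 + (r + r ^ 2)) * (√h / h * (h + ζ ^ 2))) := by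
          gcongr; exact abs_add_le_barrier (by positivity) h_pos h_le ζ
      _ = A₁ * √h / h * (h + ζ ^ 2) := by simp only [A₁]; ring
      _ ≤ (A₁ + A₂) * (√h + jumpProximity T h x) / h * (h + ζ ^ 2) := by
          gcongr
          exacts [le_add_of_nonneg_right hA₂, le_add_of_nonneg_right hS]
  · have near : |x - a| ≤ |ζ| + P * h := by
      have : κ * |z.2| ≤ κ * (r * h) := by gcongr
      simp only [P]
      linarith
    have zero_mem : (x, (0 : ℝ)) ∈ undamagedBox B b := ⟨hx, hz.2.1.trans hz.2.2, le_rfl⟩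
    calc ‖u₀ z - u₀ (x, 0)‖ ≤ M + M :=
          norm_sub_le_of_le (bound z hz) (bound _ zero_mem)
      _ = 2 * M * 1 := by ring
      _ ≤ 2 * M * ((2 + 2 * P ^ 2) * (jumpProximity T h x / h * (h + ζ ^ 2))) := by
          gcongr; exact one_le_barrier h_pos h_le ha near
      _ = A₂ * jumpProximity T h x / h * (h + ζ ^ 2) := by simp only [A₂]; ring
      _ ≤ (A₁ + A₂) * (√h + jumpProximity T h x) / h * (h + ζ ^ 2) := by
          gcongr
          exacts [le_add_of_nonneg_left hA₁, le_add_of_nonneg_left (Real.sqrt_nonneg h)]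

lemma exists_boundary_bound_of_no_jumps (hδ : 0 < δ) {C : Fin 0 → JumpCurve δ}
    (hu : IsPiecewiseC2 δ u₀ C) (hb : b < δ) (B : ℝ) (r : ℕ) :
    ∃ A : ℝ, 0 ≤ A ∧ ∀ h m : ℝ, 0 < h → h ≤ 1 → |m| ≤ r →
      ∀ z ∈ undamagedBox B b, |z.2| ≤ r * h → ∀ x ∈ Set.Icc (-B) B,
        ‖u₀ z - u₀ (x, 0) - (foot m z - x) • deriv (fun x => u₀ (x, 0)) x‖
          ≤ A * (h + (foot m z - x) ^ 2) := by
  obtain ⟨M, hM, bound⟩ := hu.exists_bound (isCompact_Icc.prod isCompact_Icc)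
    (undamagedBox_subset_undamaged hb B)
  obtain ⟨K, hK, taylor⟩ := exists_taylor_bound (hu.contDiff_trace hδ) B
  have no_jump (z : ℝ × ℝ) : z ∉ jumpSet C := fun ⟨i, _⟩ => i.elim0
  refine ⟨M * r + K * (2 + 2 * (r ^ 2) ^ 2) + K * r ^ 2, by positivity,
    fun h m h_pos h_le hm z hz height x hx => ?_⟩
  set ζ := foot m z - x with hζ
  set φ := fun x => u₀ (x, 0)
  have drift : |m * z.2| ≤ r ^ 2 * h := abs_mul_le_of_abs_le hm height
  have vertical : ‖u₀ z - φ z.1‖ ≤ M * (r * h) := by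
    calc ‖u₀ z - φ z.1‖ ≤ M * (|z.2| + |z.1 - z.1|) :=
          hu.norm_sub_le_of_path hb (fun w hw => (bound w hw).2) hz hz.1
            (fun _ _ => no_jump _) (fun _ _ => no_jump _)
      _ ≤ M * (r * h) := by rw [sub_self, abs_zero, add_zero]; gcongr
  have shift_sq : (z.1 - x) ^ 2 ≤ (2 + 2 * (r ^ 2) ^ 2) * (h + ζ ^ 2) :=
    (le_add_of_nonneg_right h_pos.le).trans
      (sq_add_le_barrier h_pos h_le (abs_fst_sub_le hm height x))
  calc ‖u₀ z - φ x - ζ • deriv φ x‖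
      = ‖(u₀ z - φ z.1) + (φ z.1 - φ x - (z.1 - x) • deriv φ x) + (m * z.2) • deriv φ x‖ := by
        rw [hζ, foot]; congr 1; module
    _ ≤ M * (r * h) + K * (z.1 - x) ^ 2 + r ^ 2 * h * K := by
        refine norm_add₃_le.trans (add_le_add_three vertical ((taylor x hx).2 z.1 hz.1) ?_)
        rw [norm_smul]
        exact mul_le_mul drift (taylor x hx).1 (norm_nonneg _) (by positivity)
    _ ≤ M * (r * (h + ζ ^ 2)) + K * ((2 + 2 * (r ^ 2) ^ 2) * (h + ζ ^ 2))
        + r ^ 2 * (h + ζ ^ 2) * K := by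
        gcongr <;> exact le_add_of_nonneg_right (sq_nonneg ζ)
    _ = (M * r + K * (2 + 2 * (r ^ 2) ^ 2) + K * r ^ 2) * (h + ζ ^ 2) := by ring

lemma exists_pointwise_bound_of_no_jumps (hδ : 0 < δ) (hr : 1 ≤ r) {C : Fin 0 → JumpCurve δ}
    (hu : IsPiecewiseC2 δ u₀ C) :
    ∃ K : ℝ, 0 ≤ K ∧ ∀ ρ v, IsStencil r ρ v → ∀ (N : ℕ) (h : ℝ), h * N = 1 → r * h < δ →
      ∀ U, IsStencilExtension r ρ N (fun p => u₀ (pos h p)) U → ∀ p₀ ∈ pixelGrid N,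
        ‖U p₀ - u₀ (foot (v.1 / v.2) (pos h p₀), 0)‖ ≤ K * h := by
  obtain ⟨A, hA, bound⟩ := hu.exists_boundary_bound_of_no_jumps hδ
    (sub_lt_self δ (div_pos hδ (mod_cast hr : (0 : ℝ) < r))) (1 + r + r ^ 2) r
  refine ⟨A * (1 + (r + r ^ 2) ^ 2 * (1 + r)), by positivity,
    fun ρ v hρ N h hh hhδ U hU p₀ hp₀ => ?_⟩
  rw [mul_assoc]
  exact hU.norm_sub_le_mul hρ hA hh (Finset.mem_Icc.1 (Finset.mem_product.1 hp₀).2)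
    fun p hp hp₂ => bound h _ (pixelWidth_pos hh) (pixelWidth_le_one hh) hρ.abs_div_le _
      (pos_mem_undamagedBox hr hh hhδ hp₀ hp hp₂) (abs_snd_pos_le (pixelWidth_pos hh) hp hp₂) _
      (foot_pos_mem_Icc hρ.abs_div_le hh hp₀)

lemma exists_pointwise_bound (hδ : 0 < δ) (hr : 1 ≤ r) (hu : IsPiecewiseC2 δ u₀ C) :
    ∃ (T : Finset ℝ) (K : ℝ), 0 ≤ K ∧ ∀ ρ v, IsStencil r ρ v → ∀ (N : ℕ) (h : ℝ), h * N = 1 →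
      r * h < δ → ∀ U, IsStencilExtension r ρ N (fun p => u₀ (pos h p)) U →
      ∀ p₀ ∈ pixelGrid N, ‖U p₀ - u₀ (foot (v.1 / v.2) (pos h p₀), 0)‖ ≤ K ∧
        ‖U p₀ - u₀ (foot (v.1 / v.2) (pos h p₀), 0)‖
          ≤ K * (√h + jumpProximity T h (foot (v.1 / v.2) (pos h p₀))) := by
  set B : ℝ := 1 + r + r ^ 2
  have r_pos : (0 : ℝ) < r := mod_cast hr
  obtain ⟨T, A, hA, bound, jump_bound⟩ := hu.exists_boundary_bound
    (sub_lt_self δ (div_pos hδ r_pos)) B r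
  let V : ℝ := 1 + (r + r ^ 2) ^ 2 * (1 + r)
  have : 0 ≤ V := by positivity
  refine ⟨T, A + A + A * V, by positivity, fun ρ v hρ N h hh hhδ U hU p₀ hp₀ => ?_⟩
  have row : p₀.2 ∈ Set.Icc 1 (N : ℤ) := Finset.mem_Icc.1 (Finset.mem_product.1 hp₀).2
  have h_pos := pixelWidth_pos hh
  set x := foot (v.1 / v.2) (pos h p₀)
  have hx : x ∈ Set.Icc (-B) B := foot_pos_mem_Icc hρ.abs_div_le hh hp₀
  have hS : 0 ≤ √h + jumpProximity T h x :=
    add_nonneg (Real.sqrt_nonneg h) (jumpProximity_nonneg T h_pos.le x)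
  have box {p} (hp : p ∈ dependenceCone r p₀) (hp₂ : p.2 ≤ 0) :
      pos h p ∈ undamagedBox B (δ - δ / r) := pos_mem_undamagedBox hr hh hhδ hp₀ hp hp₂
  have zero_mem : (x, (0 : ℝ)) ∈ undamagedBox B (δ - δ / r) :=
    ⟨hx, neg_nonpos.2 (sub_nonneg.2 (div_le_self hδ.le (mod_cast hr))), le_rfl⟩
  constructor
  · calc ‖U p₀ - u₀ (x, 0)‖ ≤ A + A := hU.norm_sub_le hρ row fun p hp hp₂ =>
          norm_sub_le_of_le (bound _ (box hp hp₂)) (bound _ zero_mem)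
      _ ≤ A + A + A * V := le_add_of_nonneg_right (by positivity)
  · calc ‖U p₀ - u₀ (x, 0)‖ ≤ A * (√h + jumpProximity T h x) / h * (V * h) :=
          hU.norm_sub_le_mul (β := 0) hρ (by positivity) hh row fun p hp hp₂ => by
            rw [smul_zero, sub_zero]
            exact jump_bound h _ h_pos (pixelWidth_le_one hh) hρ.abs_div_le _ (box hp hp₂)
              (abs_snd_pos_le h_pos hp hp₂) x hx
      _ = A * V * (√h + jumpProximity T h x) := by field_simp
      _ ≤ (A + A + A * V) * (√h + jumpProximity T h x) := by
          gcongr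
          exact le_add_of_nonneg_left (by positivity)

end IsPiecewiseC2

end Pointwise

/-! ### Discrete norms -/

section DiscreteNorm

variable {N : ℕ} {h : ℝ} {p : ℝ≥0∞} {f : ℤ × ℤ → ℝ} {K E : ℝ}

lemma div_sq_add_sq_le_arctan_sub {s : ℝ} (hs : 1 ≤ s) (t : ℝ) :
    s / (t ^ 2 + s ^ 2) ≤ 3 * (Real.arctan ((t + 1) / s) - Real.arctan (t / s)) := by
  have hs₀ : s ≠ 0 := by positivity
  have hderiv (τ : ℝ) : HasDerivAt (fun τ => Real.arctan (τ / s)) (s / (τ ^ 2 + s ^ 2)) τ := by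
    convert ((hasDerivAt_id' τ).div_const s).arctan using 1
    field_simp
    ring
  obtain ⟨τ, ⟨hτ, hτ'⟩, slope⟩ := exists_hasDerivAt_eq_slope _ _ (lt_add_one t)
    (fun τ _ => (hderiv τ).continuousAt.continuousWithinAt) fun τ _ => hderiv τ
  rw [add_sub_cancel_left, div_one] at slope
  have comparable : τ ^ 2 + s ^ 2 ≤ 3 * (t ^ 2 + s ^ 2) := by
    have : τ ^ 2 ≤ 2 * (t ^ 2 + (τ - t) ^ 2) := by simpa using add_sq_le (a := t) (b := τ - t)
    have : (τ - t) ^ 2 ≤ 1 := (sq_le_one_iff₀ (by linarith)).2 (by linarith)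
    nlinarith
  calc s / (t ^ 2 + s ^ 2) = 3 * (s / (3 * (t ^ 2 + s ^ 2))) := by field_simp
    _ ≤ 3 * (s / (τ ^ 2 + s ^ 2)) := by gcongr
    _ = _ := by rw [slope]

lemma sum_div_sq_add_sq_le {s : ℝ} (hs : 1 ≤ s) (t : ℝ) (N : ℕ) :
    ∑ i ∈ Finset.Icc 1 (N : ℤ), s / ((i - t) ^ 2 + s ^ 2) ≤ 3 * Real.pi := by
  have telescope : ∑ i ∈ Finset.Icc 1 (N : ℤ), s / ((i - t) ^ 2 + s ^ 2)
      ≤ 3 * (Real.arctan ((N + 1 - t) / s) - Real.arctan ((1 - t) / s)) := by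
    induction N with
    | zero => simp
    | succ N ih =>
      have step := div_sq_add_sq_le_arctan_sub hs (N + 1 - t)
      rw [Nat.cast_succ, ← Finset.insert_Icc_right_eq_Icc_add_one (by omega),
        Finset.sum_insert (by simp)]
      push_cast
      rw [sub_add_eq_add_sub] at step
      linarith
  linarith [Real.arctan_lt_pi_div_two ((N + 1 - t) / s),
    Real.neg_pi_div_two_lt_arctan ((1 - t) / s)]

lemma sum_row_le (hh : h * N = 1) (t : ℝ) :
    ∑ i ∈ Finset.Icc 1 (N : ℤ), h / ((i * h - t) ^ 2 + h) ≤ √N * (3 * Real.pi) := by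
  have h_pos := pixelWidth_pos hh
  have one_le_sqrt : 1 ≤ √(N : ℝ) := by
    rw [Real.one_le_sqrt, ← hh]
    exact mul_le_of_le_one_left N.cast_nonneg (pixelWidth_le_one hh)
  have sq_sqrt : √(N : ℝ) ^ 2 = N := Real.sq_sqrt N.cast_nonneg
  have rescale (i : ℤ) : h / ((i * h - t) ^ 2 + h)
      = √N * (√N / ((i - t * N) ^ 2 + √N ^ 2)) := by
    have hN : (N : ℝ) = h⁻¹ := eq_inv_of_mul_eq_one_right hh
    rw [← mul_div_assoc, ← sq, sq_sqrt, hN]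
    field_simp
  simp only [rescale, ← Finset.mul_sum]
  gcongr
  exact sum_div_sq_add_sq_le one_le_sqrt _ N

lemma sum_jumpProximity_le (hh : h * N = 1) (T : Finset ℝ) (m : ℝ) :
    (∑ q ∈ pixelGrid N, jumpProximity T h (foot m (pos h q))) * (1 / (N : ℝ)) ^ 2
      ≤ T.card * (3 * Real.pi) * √h := by
  have hN : (1 / (N : ℝ)) = h := (eq_one_div_of_mul_eq_one_left hh).symm
  have sqrt_mul : √N * √h = 1 := by
    rw [← Real.sqrt_mul N.cast_nonneg, mul_comm, hh, Real.sqrt_one]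
  have sq_sqrt : √h ^ 2 = h := Real.sq_sqrt (pixelWidth_pos hh).le
  have grid_sum : ∑ q ∈ pixelGrid N, jumpProximity T h (foot m (pos h q))
      ≤ N * (T.card * (√N * (3 * Real.pi))) := by
    calc ∑ q ∈ pixelGrid N, jumpProximity T h (foot m (pos h q))
        = ∑ j ∈ Finset.Icc 1 (N : ℤ), ∑ a ∈ T, ∑ i ∈ Finset.Icc 1 (N : ℤ),
            h / ((i * h - (m * (j * h) + a)) ^ 2 + h) := by
          rw [pixelGrid, Finset.sum_product_right]
          refine Finset.sum_congr rfl fun j _ => ?_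
          simp only [jumpProximity, foot, pos, sub_sub]
          exact Finset.sum_comm
      _ ≤ ∑ j ∈ Finset.Icc 1 (N : ℤ), ∑ a ∈ T, √N * (3 * Real.pi) :=
          Finset.sum_le_sum fun j _ => Finset.sum_le_sum fun a _ => sum_row_le hh _
      _ = N * (T.card * (√N * (3 * Real.pi))) := by
          simp only [Finset.sum_const, nsmul_eq_mul, Int.card_Icc, add_sub_cancel_right,
            Int.toNat_natCast]
  calc _ ≤ N * (T.card * (√N * (3 * Real.pi))) * h ^ 2 := by rw [hN]; gcongr
    _ = T.card * (3 * Real.pi) * (√N * √h) * √h * (h * N) := by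
        nth_rewrite 1 [sq, ← sq_sqrt]; ring
    _ = T.card * (3 * Real.pi) * √h := by rw [sqrt_mul, hh, mul_one, mul_one]

lemma sum_pixelGrid_const (hN : N ≠ 0) (c : ℝ) :
    ∑ _q ∈ pixelGrid N, c * (1 / (N : ℝ)) ^ 2 = c := by
  rw [Finset.sum_const, pixelGrid, Finset.card_product, Int.card_Icc, add_sub_cancel_right,
    Int.toNat_natCast, nsmul_eq_mul]
  push_cast
  field_simp

lemma sum_abs_le_of_jumpProximity (hh : h * N = 1) (hK : 0 ≤ K) {T : Finset ℝ} {m : ℝ}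
    (hf : ∀ q ∈ pixelGrid N, |f q| ≤ K * (√h + jumpProximity T h (foot m (pos h q)))) :
    ∑ q ∈ pixelGrid N, |f q| * (1 / (N : ℝ)) ^ 2 ≤ K * (1 + T.card * (3 * Real.pi)) * √h := by
  have hN : N ≠ 0 := Nat.cast_ne_zero.1 (right_ne_zero_of_mul_eq_one hh)
  calc ∑ q ∈ pixelGrid N, |f q| * (1 / (N : ℝ)) ^ 2
      ≤ ∑ q ∈ pixelGrid N, K * (√h + jumpProximity T h (foot m (pos h q))) * (1 / (N : ℝ)) ^ 2 := by
        gcongr with q hq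
        exact hf q hq
    _ = K * (√h + (∑ q ∈ pixelGrid N, jumpProximity T h (foot m (pos h q)))
          * (1 / (N : ℝ)) ^ 2) := by
        simp_rw [mul_assoc]
        rw [← Finset.mul_sum]
        simp_rw [add_mul]
        rw [Finset.sum_add_distrib, sum_pixelGrid_const hN, Finset.sum_mul]
    _ ≤ K * (√h + T.card * (3 * Real.pi) * √h) := by
        grw [sum_jumpProximity_le hh T m]
    _ = K * (1 + T.card * (3 * Real.pi)) * √h := by ring

lemma sum_rpow_le {P : ℝ} (hP : 1 ≤ P) (hK : 0 ≤ K) (hf : ∀ q ∈ pixelGrid N, |f q| ≤ K)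
    (hsum : ∑ q ∈ pixelGrid N, |f q| * (1 / (N : ℝ)) ^ 2 ≤ K * E) :
    ∑ q ∈ pixelGrid N, |f q| ^ P * (1 / (N : ℝ)) ^ 2 ≤ K ^ P * E := by
  have split {x : ℝ} (hx : 0 ≤ x) : x ^ P = x ^ (P - 1) * x := by
    rw [← Real.rpow_add_one' hx (by linarith), sub_add_cancel]
  calc ∑ q ∈ pixelGrid N, |f q| ^ P * (1 / (N : ℝ)) ^ 2
      ≤ ∑ q ∈ pixelGrid N, K ^ (P - 1) * (|f q| * (1 / (N : ℝ)) ^ 2) := by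
        refine Finset.sum_le_sum fun q hq => ?_
        rw [split (abs_nonneg _), mul_assoc]
        gcongr
        exact hf q hq
    _ ≤ K ^ (P - 1) * (K * E) := by rw [← Finset.mul_sum]; gcongr
    _ = K ^ P * E := by rw [split hK, mul_assoc]

lemma discreteNorm_le_of_sum_le (hp : 1 ≤ p) (hN : N ≠ 0) (hK : 0 ≤ K) (hE : 0 ≤ E)
    (hf : ∀ q ∈ pixelGrid N, |f q| ≤ K)
    (hsum : ∑ q ∈ pixelGrid N, |f q| * (1 / (N : ℝ)) ^ 2 ≤ K * E) :
    discreteNorm p N f ≤ K * E ^ (1 / p).toReal := by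
  rw [discreteNorm]
  split_ifs with hp_top
  · have : Nonempty (pixelGrid N) :=
      ⟨(1, 1), by simp only [pixelGrid, Finset.mem_product, Finset.mem_Icc]; omega⟩
    simpa [hp_top] using ciSup_le fun q : pixelGrid N => hf q q.2
  · have one_le : 1 ≤ p.toReal := ENNReal.toReal_one ▸ ENNReal.toReal_mono hp_top hp
    have exponent : (1 / p).toReal = 1 / p.toReal := by simp
    calc (∑ q ∈ pixelGrid N, |f q| ^ p.toReal * (1 / (N : ℝ)) ^ 2) ^ (1 / p.toReal)
        ≤ (K ^ p.toReal * E) ^ (1 / p.toReal) := by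
          gcongr
          exact sum_rpow_le one_le hK hf hsum
      _ = K * E ^ (1 / p).toReal := by
          rw [Real.mul_rpow (by positivity) hE, ← Real.rpow_mul hK,
            mul_one_div_cancel (by positivity), Real.rpow_one, exponent]

lemma discreteNorm_le_of_forall_le (hp : 1 ≤ p) (hN : N ≠ 0) (hK : 0 ≤ K)
    (hf : ∀ q ∈ pixelGrid N, |f q| ≤ K) : discreteNorm p N f ≤ K := by
  have := discreteNorm_le_of_sum_le hp hN hK zero_le_one hf ?_
  · rwa [Real.one_rpow, mul_one] at this
  · rw [mul_one]
    calc ∑ q ∈ pixelGrid N, |f q| * (1 / (N : ℝ)) ^ 2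
        ≤ ∑ _q ∈ pixelGrid N, K * (1 / (N : ℝ)) ^ 2 := by gcongr with q hq; exact hf q hq
      _ = K := sum_pixelGrid_const hN K

end DiscreteNorm

/-! ### The error of the algorithm -/

lemma exists_isLineAngle {v : ℝ × ℝ} (hv : v.2 ≠ 0) :
    ∃ θ, IsLineAngle v θ ∧ Real.cot θ = v.1 / v.2 := by
  set t := v.1 / v.2 with ht
  have cos_ne_zero := (Real.cos_arctan_pos t).ne'
  have sin_eq : Real.sin (Real.arctan t) = t * Real.cos (Real.arctan t) := by
    rw [← div_eq_iff cos_ne_zero, ← Real.tan_eq_sin_div_cos, Real.tan_arctan]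
  refine ⟨Real.pi / 2 - Real.arctan t, ⟨fun h => hv (by rw [h]; rfl), ⟨?_, ?_⟩, ?_⟩, ?_⟩
  · linarith [Real.arctan_lt_pi_div_two t]
  · linarith [Real.neg_pi_div_two_lt_arctan t]
  · rw [Real.sin_pi_div_two_sub, Real.cos_pi_div_two_sub, sin_eq, ht]
    field_simp
  · rw [Real.cot_eq_cos_div_sin, Real.sin_pi_div_two_sub, Real.cos_pi_div_two_sub, sin_eq,
      mul_div_cancel_right₀ _ cos_ne_zero]

/-- Error bounds for the boundary data `u₀` and the radius `r` which are uniform in the scheme and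
in its parameters: the `Lᵖ` error at pixel width `h` is at most `rate p h`. The transport direction
enters only through the cotangent of the angle `θ` of its line. -/
def HasErrorBound {d : ℕ} (δ : ℝ) (u₀ : ℝ × ℝ → Fin d → ℝ) (r : ℕ) (rate : ℝ≥0∞ → ℝ → ℝ) :
    Prop :=
  ∀ (s : Scheme) (g : ℝ × ℝ) (μ θ : ℝ),
    Real.cot θ = (transportDirection s g μ r).1 / (transportDirection s g μ r).2 →
    ∀ (N : ℕ) (h : ℝ), h * N = 1 → r * h < δ → ∀ p, 1 ≤ p → ∀ c : Fin d,
      discreteNorm p N (fun q => weakSolution u₀ θ (pos h q) c - inpainted s δ u₀ g μ r h q c)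
        ≤ rate p h

section ErrorBound

variable {d : ℕ} {δ : ℝ} {u₀ : ℝ × ℝ → Fin d → ℝ} {r : ℕ}

lemma HasErrorBound.mono {rate rate' : ℝ≥0∞ → ℝ → ℝ} (hrate : ∀ p h, 0 < h → rate p h ≤ rate' p h)
    (H : HasErrorBound δ u₀ r rate) : HasErrorBound δ u₀ r rate' :=
  fun s g μ θ hθ N h hh hδ p hp c =>
    (H s g μ θ hθ N h hh hδ p hp c).trans (hrate p h (pixelWidth_pos hh))

lemma abs_sub_apply_le {v w : Fin d → ℝ} {ε : ℝ} (hε : ‖w - v‖ ≤ ε) (c : Fin d) :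
    |v c - w c| ≤ ε :=
  (norm_le_pi_norm (v - w) c).trans (norm_sub_rev v w ▸ hε)

lemma IsPiecewiseC2.exists_hasErrorBound_of_no_jumps (hδ : 0 < δ) (hr : 2 ≤ r)
    {C : Fin 0 → JumpCurve δ} (hu : IsPiecewiseC2 δ u₀ C) :
    ∃ K : ℝ, HasErrorBound δ u₀ r fun _ h => K * h := by
  obtain ⟨K, hK, pointwise⟩ := hu.exists_pointwise_bound_of_no_jumps hδ (one_le_two.trans hr)
  refine ⟨K, fun s g μ θ hθ N h hh hrh p hp c => ?_⟩
  have h_pos := pixelWidth_pos hh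
  have hN : N ≠ 0 := Nat.cast_ne_zero.1 (right_ne_zero_of_mul_eq_one hh)
  have error_le := pointwise _ _ (isStencil_stencilWeight s g μ hr) N h hh hrh _
    (isStencilExtension_inpainted s u₀ g μ hh hrh)
  rw [← hθ] at error_le
  exact discreteNorm_le_of_forall_le hp hN (by positivity) fun q hq =>
    abs_sub_apply_le (error_le q hq) c

lemma IsPiecewiseC2.exists_hasErrorBound {n : ℕ} (hδ : 0 < δ) (hr : 2 ≤ r)
    {C : Fin n → JumpCurve δ} (hu : IsPiecewiseC2 δ u₀ C) :
    ∃ K : ℝ, HasErrorBound δ u₀ r fun p h => K * h ^ (1 / (2 * p)).toReal := by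
  obtain ⟨T, K, hK, pointwise⟩ := hu.exists_pointwise_bound hδ (one_le_two.trans hr)
  refine ⟨K * (1 + T.card * (3 * Real.pi)), fun s g μ θ hθ N h hh hrh p hp c => ?_⟩
  have h_pos := pixelWidth_pos hh
  have hN : N ≠ 0 := Nat.cast_ne_zero.1 (right_ne_zero_of_mul_eq_one hh)
  have error_le := pointwise _ _ (isStencil_stencilWeight s g μ hr) N h hh hrh _
    (isStencilExtension_inpainted s u₀ g μ hh hrh)
  rw [← hθ] at error_le
  have half_exponent : √h ^ (1 / p).toReal = h ^ (1 / (2 * p)).toReal := by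
    rw [Real.sqrt_eq_rpow, ← Real.rpow_mul h_pos.le]
    congr 1
    simp [mul_comm]
  beta_reduce
  rw [← half_exponent]
  exact discreteNorm_le_of_sum_le hp hN (by positivity) (Real.sqrt_nonneg h)
    (fun q hq => (abs_sub_apply_le (error_le q hq).1 c).trans
      (le_mul_of_one_le_right hK (le_add_of_nonneg_right (by positivity))))
    (sum_abs_le_of_jumpProximity hh hK fun q hq => abs_sub_apply_le (error_le q hq).2 c)

lemma exists_uniform_hasErrorBound (u₀ : ℝ × ℝ → Fin d → ℝ) (hδ : 0 < δ) (hr : 2 ≤ r) :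
    ∃ K : ℝ, ∀ (n : ℕ) (C : Fin n → JumpCurve δ), IsPiecewiseC2 δ u₀ C →
      HasErrorBound δ u₀ r (fun p h => K * h ^ (1 / (2 * p)).toReal) ∧
        (n = 0 → HasErrorBound δ u₀ r fun _ h => K * h) := by
  have half_order : ∃ K : ℝ, ∀ (n : ℕ) (C : Fin n → JumpCurve δ), IsPiecewiseC2 δ u₀ C →
      HasErrorBound δ u₀ r fun p h => K * h ^ (1 / (2 * p)).toReal := by
    by_cases H : ∃ (n : ℕ) (C : Fin n → JumpCurve δ), IsPiecewiseC2 δ u₀ C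
    · obtain ⟨n, C, hu⟩ := H
      exact (hu.exists_hasErrorBound hδ hr).imp fun K hK _ _ _ => hK
    · exact ⟨0, fun n C hu => (H ⟨n, C, hu⟩).elim⟩
  have first_order : ∃ K : ℝ, ∀ C : Fin 0 → JumpCurve δ, IsPiecewiseC2 δ u₀ C →
      HasErrorBound δ u₀ r fun _ h => K * h := by
    by_cases H : ∃ C : Fin 0 → JumpCurve δ, IsPiecewiseC2 δ u₀ C
    · obtain ⟨C, hu⟩ := H
      exact (hu.exists_hasErrorBound_of_no_jumps hδ hr).imp fun K hK _ _ => hK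
    · exact ⟨0, fun C hu => (H ⟨C, hu⟩).elim⟩
  obtain ⟨K₁, half_order⟩ := half_order
  obtain ⟨K₂, first_order⟩ := first_order
  refine ⟨max K₁ K₂, fun n C hu => ⟨(half_order n C hu).mono fun _ h hh => ?_, ?_⟩⟩
  · gcongr
    exact le_max_left K₁ K₂
  · rintro rfl
    refine (first_order C hu).mono fun _ h hh => ?_
    gcongr
    exact le_max_right K₁ K₂

end ErrorBound

end Inpainting

theorem theorem4p1 (d : ℕ) (δ : ℝ) (hδ : 0 < δ) (u₀ : ℝ × ℝ → Fin d → ℝ) (r : ℕ) (hr : 2 ≤ r) :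
    ∃ K : ℝ, ∀ (n : ℕ) (C : Fin n → JumpCurve δ), IsPiecewiseC2 δ u₀ C →
      ∀ (s : Scheme) (g : ℝ × ℝ) (μ : ℝ), 0 < μ →
        (transportDirection s g μ r).2 ≠ 0 ∧
        ∃ θ : ℝ, IsLineAngle (transportDirection s g μ r) θ ∧
          ∀ (N : ℕ) (h : ℝ), 0 < N → h = 1 / (N : ℝ) → h < δ / r →
            (∃ k, (stateAfter s δ u₀ g μ r h k).region = ∅) ∧
            ∀ p : ℝ≥0∞, 1 ≤ p → ∀ c : Fin d,
              (0 < n →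
                discreteNorm p N (fun q =>
                    weakSolution u₀ θ (pos h q) c - inpainted s δ u₀ g μ r h q c)
                  ≤ K * h ^ (1 / (2 * p)).toReal) ∧
              (n = 0 →
                discreteNorm p N (fun q =>
                    weakSolution u₀ θ (pos h q) c - inpainted s δ u₀ g μ r h q c)
                  ≤ K * h) := by
  obtain ⟨K, error_le⟩ := exists_uniform_hasErrorBound u₀ hδ hr
  refine ⟨K, fun n C hu s g μ _ => ?_⟩
  have snd_ne_zero : (transportDirection s g μ r).2 ≠ 0 := by
    linarith [(isStencil_stencilWeight s g μ hr).snd_le]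
  obtain ⟨θ, hθ, cot_eq⟩ := exists_isLineAngle snd_ne_zero
  refine ⟨snd_ne_zero, θ, hθ, fun N h hN hhN hhδ => ?_⟩
  have hh : h * N = 1 := by rw [hhN, one_div_mul_cancel (Nat.cast_ne_zero.2 hN.ne')]
  have hrh : r * h < δ := (lt_div_iff₀' (by positivity)).1 hhδ
  obtain ⟨half_order, first_order⟩ := error_le n C hu
  exact ⟨exists_region_eq_empty s u₀ g μ hh hrh, fun p hp c =>
    ⟨fun _ => half_order s g μ θ cot_eq N h hh hrh p hp c,
      fun hn => first_order hn s g μ θ cot_eq N h hh hrh p hp c⟩⟩
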